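/- Let $\mathcal X,\mathcal Y_1,\mathcal Y_2$ be finite alphabets and let $P_{XY_1Y_2}$, $\bar P_{XY_1Y_2}$ be pmfs on $\mathcal X\times\mathcal Y_1\times\mathcal Y_2$ with $P_{XY_1}(x,y_1)>0$ and $\bar P_{XY_1Y_2}(x,y_1,y_2)>0$ for all $x,y_1,y_2$, and $P_X\neq\bar P_X$. Let $(X_t,Y_{1,t},Y_{2,t})_{t=1}^n$ be i.i.d. $P_{XY_1Y_2}$ under $\mathcal H=0$ and i.i.d. $\bar P_{XY_1Y_2}$ under $\mathcal H=1$. A scheme of blocklength $n$ with communication alphabet sizes $(W_1,W_2)$ consists of maps $\phi_1:\mathcal X^n\to\{0,\dots,W_1-1\}$, $\phi_2:\{0,\dots,W_1-1\}\times\mathcal Y_1^n\to\{0,\dots,W_2-1\}$, $\psi_1:\{0,\dots,W_1-1\}\times\mathcal Y_1^n\to\{0,1\}$, and $\psi_2:\{0,\dots,W_1-1\}\times\{0,\dots,W_2-1\}\times\mathcal Y_2^n\to\{0,1\}$. With $M_1=\phi_1(X^n)$ and $M_2=\phi_2(M_1,Y_1^n)$, Detector 1 decides $\hat{\mathcal H}_1=\psi_1(M_1,Y_1^n)$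 and Detector 2 decides $\hat{\mathcal H}_2=\psi_2(M_1,M_2,Y_2^n)$. In concurrent detection put $$\alpha_{1,n}=\Pr\{\hat{\mathcal H}_1=0\mid\mathcal H=1\},\quad \beta_{1,n}=\Pr\{\hat{\mathcal H}_1=1\mid\mathcal H=0\},\quad \alpha_{2,n}=\Pr\{\hat{\mathcal H}_2=1\mid\mathcal H=0\},\quad \beta_{2,n}=\Pr\{\hat{\mathcal H}_2=0\mid\mathcal H=1\}.$$ A pair $\theta_1,\theta_2\ge 0$ is achievable if there is a sequence of schemes, one for each blocklength $n$, with sizes $(W_1,W_2)$ such that $\varlimsup_n\alpha_{i,n}\le 0$ and $\theta_i\le\varliminf_n -\frac1n\log\beta_{i,n}$ for $i=1,2$ (where $-\log 0=+\infty$). The error-exponents region $\mathcal E_0(W_1,W_2)$ is the closure of the set of achievable pairs. Let $\mathcal P(\mathcal X)$ be the set of pmfs on $\mathcal X$. For $S\subseteq\mathcal P(\mathcal X)$ put $$D_1(S)=\inf_{\substack{\tilde P_{XY_1}:\ \tilde P_X\in S,\\ \tilde P_{Y_1}=\bar P_{Y_1}}} D(\tilde P_{XY_1}\|P_{XY_1}),\qquad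 D_2(S)=\inf_{\substack{\tilde P_{XY_1Y_2}:\ \tilde P_X\in S,\\ \tilde P_{Y_1}=P_{Y_1},\ \tilde P_{Y_2}=P_{Y_2}}} D(\tilde P_{XY_1Y_2}\|\bar P_{XY_1Y_2}).$$ For $r\in\mathbb R$ and a map $b:\{0,1\}\to\{0,1\}$ which is either $b(0)=b(1)=0$ or $b(0)=0,\ b(1)=1$, partition $\mathcal P(\mathcal X)$ into $\Gamma_0=\Gamma_0(r,b)$ and $\Gamma_1=\Gamma_1(r,b)$ as follows: $P_X\in\Gamma_{b(0)}$ and $\bar P_X\in\Gamma_{b(1)}$; if $b(0)=b(1)=0$, every other $\pi$ lies in $\Gamma_1$ (so $\Gamma_0=\{P_X,\bar P_X\}$); if $b(0)\ne b(1)$, a $\pi\notin\{P_X,\bar P_X\}$ lies in $\Gamma_{b(1)}$ if $D_1(\{\pi\})+r\ge D_2(\{\pi\})$ and in $\Gamma_{b(0)}$ otherwise. Then for $W_1=2$ and every $W_2\ge 2$, $$\mathcal E_0(2,W_2)=\bigcup_{r,\,b}\Bigl\{(\theta_1,\theta_2):\ 0\le\theta_1\le D_1\bigl(\Gamma_{b(1)}(r,b)\bigr),\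 \ 0\le\theta_2\le D_2\bigl(\Gamma_{b(0)}(r,b)\bigr)\Bigr\},$$ the union being over all real $r$ and the two maps $b$ above. -/

import Mathlib

open scoped ENNReal
open Filter

namespace DistributedTesting

universe u v w

/-- Kullback-Leibler divergence (in nats) of two pmfs on a discrete alphabet: the
Kullback-Leibler divergence of the associated measures on the discrete sigma-algebra. -/
noncomputable def kl {α : Type u} (p q : PMF α) : ℝ≥0∞ :=
  @InformationTheory.klDiv α ⊤ (@PMF.toMeasure α ⊤ p) (@PMF.toMeasure α ⊤ q)

/-- Probability of the event `E` when the `n` letters of the block are i.i.d. with pmf `p`. -/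
noncomputable def iidProb {α : Type u} [Fintype α] (p : PMF α) (n : ℕ)
    (E : Set (Fin n → α)) : ℝ≥0∞ :=
  ∑ z : Fin n → α, E.indicator (fun z => ∏ t, p (z t)) z

section Marginals

variable {X : Type u} {Y₁ : Type v} {Y₂ : Type w}

/-- The marginal pmf of `X`. -/
noncomputable def margX (p : PMF (X × Y₁ × Y₂)) : PMF X := p.map (fun z => z.1)

/-- The marginal pmf of `Y₁`. -/
noncomputable def margY₁ (p : PMF (X × Y₁ × Y₂)) : PMF Y₁ := p.map (fun z => z.2.1)

/-- The marginal pmf of `Y₂`. -/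
noncomputable def margY₂ (p : PMF (X × Y₁ × Y₂)) : PMF Y₂ := p.map (fun z => z.2.2)

/-- The marginal pmf of the pair `(X, Y₁)`. -/
noncomputable def margXY₁ (p : PMF (X × Y₁ × Y₂)) : PMF (X × Y₁) :=
  p.map (fun z => (z.1, z.2.1))

end Marginals

section Codes

/-- A scheme of blocklength `n` with communication alphabets of sizes `W₁` and `W₂`. -/
structure Code (X : Type u) (Y₁ : Type v) (Y₂ : Type w) (W₁ W₂ n : ℕ) where
  /-- encoding function of the sensor -/
  φ₁ : (Fin n → X) → Fin W₁
  /-- encoding function of Detector 1 -/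
  φ₂ : Fin W₁ → (Fin n → Y₁) → Fin W₂
  /-- decision function of Detector 1 -/
  ψ₁ : Fin W₁ → (Fin n → Y₁) → Fin 2
  /-- decision function of Detector 2 -/
  ψ₂ : Fin W₁ → Fin W₂ → (Fin n → Y₂) → Fin 2

variable {X : Type u} {Y₁ : Type v} {Y₂ : Type w} {W₁ W₂ n : ℕ}

/-- The decision of Detector 1 on the observed block. -/
def Code.decision₁ (c : Code X Y₁ Y₂ W₁ W₂ n) (z : Fin n → X × Y₁ × Y₂) : Fin 2 :=
  c.ψ₁ (c.φ₁ fun t => (z t).1) (fun t => (z t).2.1)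

/-- The decision of Detector 2 on the observed block. -/
def Code.decision₂ (c : Code X Y₁ Y₂ W₁ W₂ n) (z : Fin n → X × Y₁ × Y₂) : Fin 2 :=
  c.ψ₂ (c.φ₁ fun t => (z t).1)
    (c.φ₂ (c.φ₁ fun t => (z t).1) (fun t => (z t).2.1)) (fun t => (z t).2.2)

variable [Fintype X] [Fintype Y₁] [Fintype Y₂]

/-- `Pr{Ĥ₁ = d | H = h}`, where `H = 0` is the law `P` and `H = 1` is the law `Pbar`. -/
noncomputable def Code.prob₁ (c : Code X Y₁ Y₂ W₁ W₂ n) (P Pbar : PMF (X × Y₁ × Y₂))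
    (d h : Fin 2) : ℝ≥0∞ :=
  iidProb (![P, Pbar] h) n {z | c.decision₁ z = d}

/-- `Pr{Ĥ₂ = d | H = h}`, where `H = 0` is the law `P` and `H = 1` is the law `Pbar`. -/
noncomputable def Code.prob₂ (c : Code X Y₁ Y₂ W₁ W₂ n) (P Pbar : PMF (X × Y₁ × Y₂))
    (d h : Fin 2) : ℝ≥0∞ :=
  iidProb (![P, Pbar] h) n {z | c.decision₂ z = d}

/-- Achievability of a pair of (nonnegative) error exponents with fixed communication alphabets
of sizes `W₁`, `W₂`. The parameter `hbar₁` is the hypothesis under which Detector 1 maximises its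
error exponent, and `hbar₁ + 1` (addition modulo 2) is the other one; Detector 2 always maximises
its exponent under hypothesis `1`. The exponent of a vanishing error probability is `+∞`. -/
def Achievable (P Pbar : PMF (X × Y₁ × Y₂)) (hbar₁ : Fin 2) (W₁ W₂ : ℕ) (θ : ℝ × ℝ) : Prop :=
  0 ≤ θ.1 ∧ 0 ≤ θ.2 ∧
  ∃ c : ∀ n : ℕ, Code X Y₁ Y₂ W₁ W₂ n,
    limsup (fun n => (c n).prob₁ P Pbar hbar₁ (hbar₁ + 1)) atTop ≤ 0 ∧
    limsup (fun n => (c n).prob₂ P Pbar 1 0) atTop ≤ 0 ∧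
    (θ.1 : EReal) ≤ liminf (fun n : ℕ =>
      -(ENNReal.log ((c n).prob₁ P Pbar (hbar₁ + 1) hbar₁)) / (n : EReal)) atTop ∧
    (θ.2 : EReal) ≤ liminf (fun n : ℕ =>
      -(ENNReal.log ((c n).prob₂ P Pbar 0 1)) / (n : EReal)) atTop

/-- The error-exponents region for fixed communication alphabets. -/
def exponentsRegion (P Pbar : PMF (X × Y₁ × Y₂)) (hbar₁ : Fin 2) (W₁ W₂ : ℕ) : Set (ℝ × ℝ) :=
  closure {θ | Achievable P Pbar hbar₁ W₁ W₂ θ}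

end Codes

section Region

variable {X : Type u} {Y₁ : Type v} {Y₂ : Type w}

/-- The infimum of `D(P̃_{XY₁} ‖ P_{XY₁})` over all pmfs `P̃_{XY₁}` with `X`-marginal in `S` and
`Y₁`-marginal equal to that of `Pbar`. -/
noncomputable def minDiv₁ (P Pbar : PMF (X × Y₁ × Y₂)) (S : Set (PMF X)) : ℝ≥0∞ :=
  ⨅ (p : PMF (X × Y₁)) (_ : p.map Prod.fst ∈ S) (_ : p.map Prod.snd = margY₁ Pbar),
    kl p (margXY₁ P)

/-- The infimum of `D(P̃_{XY₁Y₂} ‖ Pbar_{XY₁Y₂})` over all pmfs `P̃_{XY₁Y₂}` with `X`-marginal in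
`S` and with the same `Y₁`- and `Y₂`-marginals as `P`. -/
noncomputable def minDiv₂ (P Pbar : PMF (X × Y₁ × Y₂)) (S : Set (PMF X)) : ℝ≥0∞ :=
  ⨅ (p : PMF (X × Y₁ × Y₂)) (_ : margX p ∈ S) (_ : margY₁ p = margY₁ P)
    (_ : margY₂ p = margY₂ P), kl p Pbar

/-- The map `b` with `b(0) = b(1) = 0`. -/
def bSame : Fin 2 → Fin 2 := ![0, 0]

/-- The map `b` with `b(0) = 0` and `b(1) = 1`. -/
def bDiff : Fin 2 → Fin 2 := ![0, 1]

open Classical in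
/-- The index `m` of the set `Γ_m` to which the pmf `π` on the sensor alphabet is assigned, for the
map `b` and the threshold `r`: `P_X` gets `b(0)` and `Pbar_X` gets `b(1)`; every other `π` gets `1`
if `b(0) = b(1) (= 0)`, and is assigned by comparing two divergences otherwise. -/
noncomputable def typeIndex (P Pbar : PMF (X × Y₁ × Y₂)) (b : Fin 2 → Fin 2) (r : ℝ)
    (π : PMF X) : Fin 2 :=
  if π = margX P then b 0
  else if π = margX Pbar then b 1
  else if b 0 = b 1 then 1
  else if (minDiv₂ P Pbar {π} : EReal) ≤ (minDiv₁ P Pbar {π} : EReal) + (r : EReal) then b 1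
  else b 0

/-- The set `Γ_m`. The sets `Γ_0` and `Γ_1` partition the pmfs on the sensor alphabet. -/
def Gam (P Pbar : PMF (X × Y₁ × Y₂)) (b : Fin 2 → Fin 2) (r : ℝ) (m : Fin 2) : Set (PMF X) :=
  {π | typeIndex P Pbar b r π = m}

end Region

end DistributedTesting

/-!
The region has a description without thresholds (`exists_threshold_iff`). If the sensor sends the
same bit for the typical sequences of both hypotheses, both of its marginals `P_X` and `Pbar_X`
constrain both exponents (`SameBit`). If it sends different bits, every sensor law `π` constrains
one of the two exponents, according to the bit sent for the sequences of type `π` (`DiffBit`); the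
threshold `r = θ₂ - θ₁` then separates the two cases. Both conditions are closed in `(θ₁, θ₂)`.

*Upper bounds on the exponents.* If the sides of a rectangle `A × B × C` of blocks have
probabilities bounded below under the marginals of a pmf `p`, a block drawn from `p` can be moved
into the rectangle by `O(√n)` letter changes on average (`exists_map_into_of_prob_ge`), because the
Hamming distance to a set has variance at most `n`. Since `q` is invariant under the noise that
resamples each letter with a small probability, and by Jensen's inequality, the rectangle has
`q`-probability at least `exp (-n (D(p‖q) + η))` for large `n` (`exp_le_iidReal`). For a reliable
scheme, such rectangles lie in the error event of each detector for every `π` under which the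
relevant bit of the sensor has probability at least `ε`, and under each `π` one of the two bits has
probability at least `1/2`. No types and no typical sets are needed in this direction.

*Construction of schemes.* The sensor sends a bit that depends on the type of its block, and a
detector decides for the hypothesis that it must not miss if the bit and the types of the other
blocks fit. The errors that have to vanish do so by Chebyshev's inequality, and the others are
bounded by counting types (`iidReal_le_of_le_klSum`). Types match the prescribed marginals only
approximately; closeness is measured by `Near`, so that mixing with a product pmf of small weight
restores the exact marginals, at a small cost by the convexity of relative entropy
(`exists_marginals_eq`, `exists_marginals_eq₃`).
-/

namespace DistributedTesting

/-! ### Expectations over an i.i.d. block -/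

section Iid

variable {α β : Type*} [Fintype α] [Fintype β]

/-- Expectation of `f (Z₁, …, Zₙ)` for letters that are i.i.d. with pmf `p`, as a finite real
sum. -/
noncomputable def iidExp (p : PMF α) (n : ℕ) (f : (Fin n → α) → ℝ) : ℝ :=
  ∑ z, (∏ t, (p (z t)).toReal) * f z

lemma sum_toReal_pmf (p : PMF α) : ∑ a, (p a).toReal = 1 := by
  rw [← ENNReal.toReal_sum fun a _ => p.apply_ne_top a, ← tsum_fintype (L := .unconditional α),
    p.tsum_coe, ENNReal.toReal_one]

lemma prod_toReal_nonneg {α : Type*} (p : PMF α) {n : ℕ} (z : Fin n → α) :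
    0 ≤ ∏ t, (p (z t)).toReal :=
  Finset.prod_nonneg fun _ _ => ENNReal.toReal_nonneg

/-- Conditioning on the first letter; the recursion behind the inductions on the blocklength. -/
lemma iidExp_succ (p : PMF α) (n : ℕ) (f : (Fin (n + 1) → α) → ℝ) :
    iidExp p (n + 1) f = ∑ a, (p a).toReal * iidExp p n (fun z => f (Fin.cons a z)) := by
  unfold iidExp
  rw [← (Fin.consEquiv fun _ => α).sum_comp, Fintype.sum_prod_type]
  refine Finset.sum_congr rfl fun a _ => ?_
  rw [Finset.mul_sum]
  refine Finset.sum_congr rfl fun z _ => ?_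
  simp [Fin.consEquiv, Fin.prod_univ_succ, mul_assoc]

lemma iidExp_const (p : PMF α) (n : ℕ) (c : ℝ) : iidExp p n (fun _ => c) = c := by
  induction n with
  | zero => simp [iidExp]
  | succ n ih => simp only [iidExp_succ, ih]; rw [← Finset.sum_mul, sum_toReal_pmf, one_mul]

lemma iidExp_mono (p : PMF α) (n : ℕ) {f g : (Fin n → α) → ℝ} (h : ∀ z, f z ≤ g z) :
    iidExp p n f ≤ iidExp p n g :=
  Finset.sum_le_sum fun z _ => mul_le_mul_of_nonneg_left (h z) (prod_toReal_nonneg p z)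

lemma iidExp_add (p : PMF α) (n : ℕ) (f g : (Fin n → α) → ℝ) :
    iidExp p n (fun z => f z + g z) = iidExp p n f + iidExp p n g := by
  simp only [iidExp, mul_add, Finset.sum_add_distrib]

lemma iidExp_sub (p : PMF α) (n : ℕ) (f g : (Fin n → α) → ℝ) :
    iidExp p n (fun z => f z - g z) = iidExp p n f - iidExp p n g := by
  simp only [iidExp, mul_sub, Finset.sum_sub_distrib]

lemma iidExp_const_mul (p : PMF α) (n : ℕ) (c : ℝ) (f : (Fin n → α) → ℝ) :
    iidExp p n (fun z => c * f z) = c * iidExp p n f := by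
  simp only [iidExp, Finset.mul_sum]
  exact Finset.sum_congr rfl fun z _ => by ring

lemma sum_toReal_map (p : PMF α) (g : α → β) (h : β → ℝ) :
    ∑ b, ((p.map g) b).toReal * h b = ∑ a, (p a).toReal * h (g a) := by
  classical
  have : ∀ b, ((p.map g) b).toReal = ∑ a, if b = g a then (p a).toReal else 0 := by
    intro b
    rw [PMF.map_apply, tsum_fintype, ENNReal.toReal_sum]
    · exact Finset.sum_congr rfl fun a _ => by split_ifs <;> simp
    · intro a _; split_ifs
      · exact p.apply_ne_top a
      · simp
  simp only [this, Finset.sum_mul]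
  rw [Finset.sum_comm]
  refine Finset.sum_congr rfl fun a _ => ?_
  simp [ite_mul]

/-- A letterwise function of an i.i.d. block is i.i.d. with the image pmf. -/
lemma iidExp_map (p : PMF α) (g : α → β) (n : ℕ) (f : (Fin n → β) → ℝ) :
    iidExp (p.map g) n f = iidExp p n (fun z => f (fun t => g (z t))) := by
  induction n with
  | zero =>
    simp only [iidExp, Fintype.sum_unique, Finset.univ_eq_empty, Finset.prod_empty]
    congr 2
    ext t; exact t.elim0
  | succ n ih =>
    rw [iidExp_succ, iidExp_succ, sum_toReal_map p g
      (fun b => iidExp (p.map g) n (fun z => f (Fin.cons b z)))]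
    refine Finset.sum_congr rfl fun a _ => ?_
    rw [ih]
    congr 2
    ext z
    congr 1
    ext t
    refine Fin.cases ?_ (fun i => ?_) t <;> simp

lemma iidExp_sum_coord (p : PMF α) (n : ℕ) (g : α → ℝ) :
    iidExp p n (fun z => ∑ t, g (z t)) = n * ∑ a, (p a).toReal * g a := by
  induction n with
  | zero => simp [iidExp]
  | succ n ih =>
    rw [iidExp_succ]
    simp only [Fin.sum_univ_succ, Fin.cons_zero, Fin.cons_succ, iidExp_add, iidExp_const, ih]
    simp only [mul_add, Finset.sum_add_distrib]
    rw [← Finset.sum_mul, sum_toReal_pmf]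
    push_cast; ring

/-- A Hamming-Lipschitz function of an i.i.d. block has variance at most the blocklength. -/
lemma iidExp_sq_le [DecidableEq α] (p : PMF α) (n : ℕ) (f : (Fin n → α) → ℝ)
    (hf : ∀ z z', |f z - f z'| ≤ hammingDist z z') :
    iidExp p n (fun z => f z ^ 2) ≤ iidExp p n f ^ 2 + n := by
  induction n with
  | zero => simp [iidExp]
  | succ n ih =>
    set g : α → ℝ := fun a => iidExp p n (fun z => f (Fin.cons a z)) with hg
    have hcons : ∀ a a' (z z' : Fin n → α),
        hammingDist (Fin.cons a z : Fin (n + 1) → α) (Fin.cons a' z')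
          = (if a ≠ a' then 1 else 0) + hammingDist z z' := by
      intro a a' z z'
      simp only [hammingDist, Finset.card_filter, Fin.sum_univ_succ, Fin.cons_zero, Fin.cons_succ]
    have hosc : ∀ a a', g a - g a' ≤ 1 := by
      intro a a'
      rw [hg]
      simp only
      rw [← iidExp_sub, ← iidExp_const p n 1]
      refine iidExp_mono p n fun z => (le_abs_self _).trans ((hf _ _).trans ?_)
      rw [hcons, hammingDist_self]
      split_ifs <;> simp
    set m : ℝ := iidExp p (n + 1) f with hm
    have hmg : m = ∑ a, (p a).toReal * g a := by rw [hm, iidExp_succ]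
    have hdev : ∀ a, (g a - m) ^ 2 ≤ 1 := by
      intro a
      have hp : ∀ b, 0 ≤ (p b).toReal := fun b => ENNReal.toReal_nonneg
      have h1 : g a - m ≤ 1 := by
        have : g a - m = ∑ b, (p b).toReal * (g a - g b) := by
          simp only [mul_sub, Finset.sum_sub_distrib]
          rw [← Finset.sum_mul, sum_toReal_pmf, hmg, one_mul]
        rw [this, ← sum_toReal_pmf p]
        exact Finset.sum_le_sum fun b _ => by nlinarith [hp b, hosc a b]
      have h2 : m - g a ≤ 1 := by
        have : m - g a = ∑ b, (p b).toReal * (g b - g a) := by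
          simp only [mul_sub, Finset.sum_sub_distrib]
          rw [← Finset.sum_mul, sum_toReal_pmf, hmg, one_mul]
        rw [this, ← sum_toReal_pmf p]
        exact Finset.sum_le_sum fun b _ => by nlinarith [hp b, hosc b a]
      nlinarith
    have hvar : ∑ a, (p a).toReal * g a ^ 2 ≤ m ^ 2 + 1 := by
      have h1 : ∑ a, (p a).toReal * (g a - m) ^ 2 ≤ 1 := by
        conv_rhs => rw [← sum_toReal_pmf p]
        exact Finset.sum_le_sum fun b _ =>
          mul_le_of_le_one_right ENNReal.toReal_nonneg (hdev b)
      have h2 : ∑ a, (p a).toReal * (g a - m) ^ 2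
          = ∑ a, (p a).toReal * g a ^ 2 - 2 * m * ∑ a, (p a).toReal * g a
            + m ^ 2 * ∑ a, (p a).toReal := by
        rw [Finset.mul_sum, Finset.mul_sum, ← Finset.sum_sub_distrib, ← Finset.sum_add_distrib]
        exact Finset.sum_congr rfl fun a _ => by ring
      rw [h2, sum_toReal_pmf, ← hmg] at h1
      linarith
    rw [iidExp_succ]
    calc ∑ a, (p a).toReal * iidExp p n (fun z => f (Fin.cons a z) ^ 2)
        ≤ ∑ a, (p a).toReal * (g a ^ 2 + n) := by
          refine Finset.sum_le_sum fun a _ =>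
            mul_le_mul_of_nonneg_left (ih _ fun z z' => ?_) ENNReal.toReal_nonneg
          refine (hf _ _).trans ?_
          rw [hcons]; simp
      _ = ∑ a, (p a).toReal * g a ^ 2 + n := by
          simp only [mul_add, Finset.sum_add_distrib]
          rw [← Finset.sum_mul, sum_toReal_pmf, one_mul]
      _ ≤ m ^ 2 + (n + 1 : ℕ) := by push_cast; linarith

/-- Real-valued probability of the event `E` for an i.i.d. block. -/
noncomputable def iidReal (p : PMF α) (n : ℕ) (E : Set (Fin n → α)) : ℝ :=
  iidExp p n (E.indicator fun _ => 1)

lemma iidProb_eq_ofReal (p : PMF α) (n : ℕ) (E : Set (Fin n → α)) :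
    iidProb p n E = ENNReal.ofReal (iidReal p n E) := by
  classical
  unfold iidProb iidReal iidExp
  rw [ENNReal.ofReal_sum_of_nonneg]
  · refine Finset.sum_congr rfl fun z _ => ?_
    by_cases hz : z ∈ E
    · simp only [Set.indicator_of_mem hz, mul_one]
      rw [ENNReal.ofReal_prod_of_nonneg fun _ _ => ENNReal.toReal_nonneg]
      exact Finset.prod_congr rfl fun t _ => (ENNReal.ofReal_toReal (p.apply_ne_top _)).symm
    · simp [Set.indicator_of_notMem hz]
  · exact fun z _ => mul_nonneg (prod_toReal_nonneg p z)
      (Set.indicator_nonneg (fun _ _ => zero_le_one) _)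

lemma iidReal_nonneg (p : PMF α) (n : ℕ) (E : Set (Fin n → α)) : 0 ≤ iidReal p n E :=
  Finset.sum_nonneg fun z _ => mul_nonneg (prod_toReal_nonneg p z)
    (Set.indicator_nonneg (fun _ _ => zero_le_one) _)

lemma iidReal_mono (p : PMF α) (n : ℕ) {E F : Set (Fin n → α)} (h : E ⊆ F) :
    iidReal p n E ≤ iidReal p n F :=
  iidExp_mono p n fun z => Set.indicator_le_indicator_of_subset h (fun _ => zero_le_one) z

lemma iidReal_compl (p : PMF α) (n : ℕ) (E : Set (Fin n → α)) :
    iidReal p n Eᶜ = 1 - iidReal p n E := by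
  have : iidReal p n Eᶜ + iidReal p n E = 1 := by
    unfold iidReal
    refine ((iidExp_add p n _ _).symm.trans ?_).trans (iidExp_const p n 1)
    congr 1
    ext z
    by_cases hz : z ∈ E <;> simp [hz]
  linarith

lemma iidReal_iUnion_le {ι : Type*} [Fintype ι] (p : PMF α) (n : ℕ)
    (E : ι → Set (Fin n → α)) : iidReal p n (⋃ i, E i) ≤ ∑ i, iidReal p n (E i) := by
  classical
  have : ∑ i, iidReal p n (E i) =
      iidExp p n (fun z => ∑ i, (E i).indicator (fun _ => (1 : ℝ)) z) := by
    simp only [iidReal, iidExp, Finset.mul_sum]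
    exact Finset.sum_comm
  rw [this]
  refine iidExp_mono p n fun z => ?_
  have hnn : ∀ i ∈ Finset.univ, 0 ≤ (E i).indicator (fun _ => (1 : ℝ)) z :=
    fun i _ => Set.indicator_nonneg (fun _ _ => zero_le_one) _
  by_cases hz : z ∈ ⋃ i, E i
  · obtain ⟨i, hi⟩ := Set.mem_iUnion.1 hz
    refine le_trans ?_ (Finset.single_le_sum hnn (Finset.mem_univ i))
    simp [hi, hz]
  · rw [Set.indicator_of_notMem hz]
    exact Finset.sum_nonneg hnn

lemma iidReal_map (p : PMF α) (g : α → β) (n : ℕ) (E : Set (Fin n → β)) :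
    iidReal (p.map g) n E = iidReal p n {z | (fun t => g (z t)) ∈ E} := by
  unfold iidReal
  rw [iidExp_map]
  rfl

/-- Chebyshev's inequality for a Hamming-Lipschitz function of an i.i.d. block. -/
lemma iidReal_chebyshev [DecidableEq α] (p : PMF α) (n : ℕ) (f : (Fin n → α) → ℝ)
    (hf : ∀ z z', |f z - f z'| ≤ hammingDist z z') (E : Set (Fin n → α)) (η : ℝ)
    (hE : ∀ z ∈ E, η ≤ (f z - iidExp p n f) ^ 2) : iidReal p n E * η ≤ n := by
  set m := iidExp p n f with hm
  have h1 : iidExp p n (fun z => (f z - m) ^ 2) ≤ n := by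
    have : iidExp p n (fun z => (f z - m) ^ 2)
        = iidExp p n (fun z => f z ^ 2) - 2 * m * iidExp p n f + m ^ 2 := by
      rw [← iidExp_const_mul, ← iidExp_sub, ← iidExp_const p n (m ^ 2), ← iidExp_add]
      congr 1
      ext z; ring
    rw [this, ← hm]
    linarith [iidExp_sq_le p n f hf]
  refine le_trans ?_ h1
  rw [mul_comm, iidReal, ← iidExp_const_mul]
  refine iidExp_mono p n fun z => ?_
  by_cases hz : z ∈ E
  · simpa [hz] using hE z hz
  · simpa [hz] using sq_nonneg _

/-- The substitute for the blowing-up lemma: the average number of letters that have to be changed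
in order to move an i.i.d. block into a set of probability at least `c` is at most `√(n / c)`. -/
lemma exists_map_into_of_prob_ge [DecidableEq α] (p : PMF α) (n : ℕ) (A : Set (Fin n → α)) {c : ℝ}
    (hc : 0 < c) (hA : c ≤ iidReal p n A) :
    ∃ e : (Fin n → α) → (Fin n → α), (∀ z, e z ∈ A) ∧
      iidExp p n (fun z => (hammingDist z (e z) : ℝ)) ≤ √(n / c) := by
  have hne : A.Nonempty := by
    by_contra h
    rw [Set.not_nonempty_iff_eq_empty] at h
    subst h
    have : iidReal p n ∅ = 0 := by simp [iidReal, iidExp]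
    linarith
  have hex : ∀ z, ∃ a ∈ A, ∀ b ∈ A, hammingDist z a ≤ hammingDist z b := fun z =>
    Set.exists_min_image A (fun b => hammingDist z b) A.toFinite hne
  choose e heA he using hex
  refine ⟨e, heA, ?_⟩
  set f : (Fin n → α) → ℝ := fun z => (hammingDist z (e z) : ℝ) with hfdef
  have hstep : ∀ z z', f z - f z' ≤ hammingDist z z' := by
    intro z z'
    have h := (he z _ (heA z')).trans (hammingDist_triangle z z' (e z'))
    have h' : f z ≤ hammingDist z z' + f z' := by simp only [hfdef]; exact_mod_cast h
    linarith
  have hf : ∀ z z', |f z - f z'| ≤ hammingDist z z' := by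
    intro z z'
    rw [abs_le]
    have h := hstep z' z
    rw [hammingDist_comm] at h
    exact ⟨by linarith, hstep z z'⟩
  -- The distance vanishes on `A`, so it deviates there from its mean by the mean itself.
  have hcheb := iidReal_chebyshev p n f hf A (iidExp p n f ^ 2) fun z hz => by
    have : f z = 0 := by
      have := he z z hz
      rw [hammingDist_self] at this
      simp only [hfdef]
      exact_mod_cast Nat.le_zero.1 this
    rw [this]; simp
  refine Real.le_sqrt_of_sq_le ?_
  rw [le_div_iff₀ hc]
  nlinarith [sq_nonneg (iidExp p n f)]

end Iid

/-! ### Relative entropy on a finite alphabet -/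

section KL

variable {α : Type*} [Fintype α]

/-- Relative entropy of pmfs on a finite alphabet as a real sum; it agrees with `kl` when the second
argument has full support. -/
noncomputable def klSum (p q : PMF α) : ℝ :=
  ∑ a, (p a).toReal * (Real.log (p a).toReal - Real.log (q a).toReal)

lemma kl_eq_klSum (p q : PMF α) (hq : ∀ a, 0 < q a) :
    kl p q ≠ ⊤ ∧ (kl p q).toReal = klSum p q := by
  let _ : MeasurableSpace α := ⊤
  have : MeasurableSingletonClass α := ⟨fun _ => trivial⟩
  have hac : p.toMeasure.AbsolutelyContinuous q.toMeasure := by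
    intro s hs
    rw [PMF.toMeasure_apply_eq_zero_iff q (by trivial)] at hs
    have hsupp : q.support = Set.univ := by ext a; simp [(hq a).ne']
    rw [hsupp, Set.univ_disjoint] at hs
    simp [hs]
  have hint : MeasureTheory.Integrable (MeasureTheory.llr p.toMeasure q.toMeasure) p.toMeasure :=
    MeasureTheory.Integrable.of_finite
  refine ⟨InformationTheory.klDiv_ne_top hac hint, ?_⟩
  unfold kl
  rw [InformationTheory.toReal_klDiv_of_measure_eq hac (by simp), PMF.integral_eq_sum]
  unfold klSum
  refine Finset.sum_congr rfl fun a _ => ?_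
  rcases eq_or_ne (p a) 0 with h0 | h0
  · simp [h0]
  have hrn : p.toMeasure.rnDeriv q.toMeasure a * q a = p a := by
    have h1 := congrArg (fun μ : MeasureTheory.Measure α => μ {a})
      (MeasureTheory.Measure.withDensity_rnDeriv_eq _ _ hac)
    rw [MeasureTheory.withDensity_apply _ (by trivial), MeasureTheory.lintegral_singleton,
      PMF.toMeasure_apply_singleton _ _ (by trivial),
      PMF.toMeasure_apply_singleton _ _ (by trivial)] at h1
    exact h1
  have hqr : (q a).toReal ≠ 0 := (ENNReal.toReal_pos (hq a).ne' (q.apply_ne_top a)).ne'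
  have hpr : (p a).toReal ≠ 0 := (ENNReal.toReal_pos h0 (p.apply_ne_top a)).ne'
  have hrn' : (p.toMeasure.rnDeriv q.toMeasure a).toReal = (p a).toReal / (q a).toReal := by
    rw [eq_div_iff hqr, ← ENNReal.toReal_mul, hrn]
  simp only [MeasureTheory.llr, hrn', smul_eq_mul, Real.log_div hpr hqr]

lemma ofReal_le_kl_iff (p q : PMF α) (hq : ∀ a, 0 < q a) {θ : ℝ} :
    ENNReal.ofReal θ ≤ kl p q ↔ θ ≤ klSum p q := by
  obtain ⟨h1, h2⟩ := kl_eq_klSum p q hq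
  rw [← h2, ENNReal.ofReal_le_iff_le_toReal h1]

/-- Relative entropy is convex in its first argument. -/
lemma klSum_le_of_mix {p p₀ ρ q : PMF α} {t : ℝ} (ht0 : 0 ≤ t) (ht1 : t ≤ 1)
    (hp : ∀ a, (p a).toReal = (1 - t) * (p₀ a).toReal + t * (ρ a).toReal) :
    klSum p q ≤ (1 - t) * klSum p₀ q + t * klSum ρ q := by
  unfold klSum
  rw [Finset.mul_sum, Finset.mul_sum, ← Finset.sum_add_distrib]
  refine Finset.sum_le_sum fun a _ => ?_
  have h := Real.convexOn_mul_log.2 (x := (p₀ a).toReal) (y := (ρ a).toReal)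
    ENNReal.toReal_nonneg ENNReal.toReal_nonneg (sub_nonneg.2 ht1) ht0 (by ring)
  simp only [smul_eq_mul] at h
  rw [← hp a] at h
  have := hp a
  calc (p a).toReal * (Real.log (p a).toReal - Real.log (q a).toReal)
      = (p a).toReal * Real.log (p a).toReal - (p a).toReal * Real.log (q a).toReal := by ring
    _ ≤ _ := by
      conv_lhs => rw [hp a]
      rw [hp a] at h
      linarith

lemma klSum_le_neg_log {p q : PMF α} {m : ℝ} (hm : 0 < m) (hq : ∀ a, m ≤ (q a).toReal) :
    klSum p q ≤ -Real.log m := by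
  have : -Real.log m = ∑ a, (p a).toReal * (-Real.log m) := by
    rw [← Finset.sum_mul, sum_toReal_pmf, one_mul]
  rw [this]
  refine Finset.sum_le_sum fun a _ => mul_le_mul_of_nonneg_left ?_ ENNReal.toReal_nonneg
  have h1 : Real.log (p a).toReal ≤ 0 := Real.log_nonpos ENNReal.toReal_nonneg
    (ENNReal.toReal_le_of_le_ofReal zero_le_one (by simpa using p.coe_le_one a))
  have h2 := Real.log_le_log hm (hq a)
  linarith

lemma klSum_nonneg (p q : PMF α) (hq : ∀ a, 0 < q a) : 0 ≤ klSum p q :=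
  (kl_eq_klSum p q hq).2 ▸ ENNReal.toReal_nonneg

lemma exists_pos_le_pmf (q : PMF α) (hq : ∀ a, 0 < q a) :
    ∃ m : ℝ, 0 < m ∧ m ≤ 1 ∧ ∀ a, m ≤ (q a).toReal := by
  obtain ⟨a₀, _⟩ := q.support_nonempty
  obtain ⟨a, _, ha⟩ := Finset.exists_min_image Finset.univ (fun a => (q a).toReal) ⟨a₀, by simp⟩
  exact ⟨(q a).toReal, ENNReal.toReal_pos (hq a).ne' (q.apply_ne_top a),
    ENNReal.toReal_le_of_le_ofReal zero_le_one (by simpa using q.coe_le_one a),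
    fun b => ha b (Finset.mem_univ b)⟩

end KL

/-! ### Lower bounds on the probability of large product sets -/

section ChangeOfMeasure

variable {α : Type*} [Fintype α]

/-- The letterwise noise that resamples a letter from `q` with probability `δ` leaves the i.i.d. law
`q` invariant. Hence an event `E` is at least as likely as the event that the noisy block is moved
from `z` exactly to the prescribed point `e z` of `E`. -/
lemma sum_prod_kernel_le_iidReal [DecidableEq α] (q : PMF α) {δ : ℝ} (hδ0 : 0 < δ) (hδ1 : δ < 1)
    (n : ℕ) (E : Set (Fin n → α)) (e : (Fin n → α) → (Fin n → α)) (he : ∀ z, e z ∈ E) :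
    iidExp q n (fun z => ∏ t, ((if z t = e z t then 1 - δ else 0) + δ * (q (e z t)).toReal))
      ≤ iidReal q n E := by
  set K : α → α → ℝ := fun a b => (if a = b then 1 - δ else 0) + δ * (q b).toReal with hK
  have hK0 : ∀ a b, 0 ≤ K a b := by
    intro a b
    have : 0 ≤ δ * (q b).toReal := mul_nonneg hδ0.le ENNReal.toReal_nonneg
    simp only [hK]
    split_ifs <;> linarith
  have hstat : ∀ b, ∑ a, (q a).toReal * K a b = (q b).toReal := by
    intro b
    simp only [hK, mul_add, Finset.sum_add_distrib, mul_ite, mul_zero]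
    rw [← Finset.sum_mul, sum_toReal_pmf]
    simp; ring
  have hstat' : ∀ z' : Fin n → α,
      ∏ t, (q (z' t)).toReal = ∑ z : Fin n → α, ∏ t, ((q (z t)).toReal * K (z t) (z' t)) := by
    intro z'
    calc ∏ t, (q (z' t)).toReal = ∏ t, ∑ a, (q a).toReal * K a (z' t) := by simp only [hstat]
      _ = _ := by rw [Finset.prod_univ_sum, Fintype.piFinset_univ]
  have hE : iidReal q n E = ∑ z : Fin n → α, ∑ z' : Fin n → α,
      (∏ t, ((q (z t)).toReal * K (z t) (z' t))) * E.indicator (fun _ => (1 : ℝ)) z' := by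
    unfold iidReal iidExp
    simp only [hstat', Finset.sum_mul]
    exact Finset.sum_comm
  rw [hE]
  refine Finset.sum_le_sum fun z _ => ?_
  have hsingle := Finset.single_le_sum
    (f := fun z' => (∏ t, ((q (z t)).toReal * K (z t) (z' t))) * E.indicator (fun _ => (1 : ℝ)) z')
    (fun z' _ => mul_nonneg (Finset.prod_nonneg fun t _ =>
      mul_nonneg ENNReal.toReal_nonneg (hK0 _ _)) (Set.indicator_nonneg (fun _ _ => zero_le_one) _))
    (Finset.mem_univ (e z))
  refine le_trans (le_of_eq ?_) hsingle
  simp only [Set.indicator_of_mem (he z), mul_one, Finset.prod_mul_distrib, hK]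

/-- Change of measure from `p` to `q` for an event that is close, on average under `p`, to the
block: an event `E` into which a block drawn from `p` can be moved by few letter changes has
`q`-probability of exponent at most about the relative entropy of `p` from `q`. -/
lemma exp_le_iidReal [DecidableEq α] (p q : PMF α) {m : ℝ} (hm : 0 < m)
    (hqm : ∀ a, m ≤ (q a).toReal) {δ : ℝ} (hδ0 : 0 < δ) (hδ1 : δ < 1)
    (n : ℕ) (E : Set (Fin n → α)) (e : (Fin n → α) → (Fin n → α)) (he : ∀ z, e z ∈ E) :
    Real.exp (-(n * klSum p q) + n * Real.log (1 - δ)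
        + Real.log (δ * m) * iidExp p n (fun z => (hammingDist z (e z) : ℝ)))
      ≤ iidReal q n E := by
  set k : (Fin n → α) → ℝ := fun z =>
    n * Real.log (1 - δ) + Real.log (δ * m) * (hammingDist z (e z) : ℝ) with hk
  set l : (Fin n → α) → ℝ := fun z =>
    (∑ t, (Real.log (q (z t)).toReal - Real.log (p (z t)).toReal)) + k z with hl
  have hker : ∀ z, Real.exp (k z) ≤
      ∏ t, ((if z t = e z t then 1 - δ else 0) + δ * (q (e z t)).toReal) := by
    intro z
    have hkz : k z = ∑ t, (Real.log (1 - δ) + if z t ≠ e z t then Real.log (δ * m) else 0) := by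
      simp only [hk, Finset.sum_add_distrib, hammingDist, Finset.card_filter, Nat.cast_sum,
        Finset.mul_sum]
      simp
    rw [hkz, Real.exp_sum]
    refine Finset.prod_le_prod (fun t _ => (Real.exp_pos _).le) fun t _ => ?_
    rw [Real.exp_add, Real.exp_log (by linarith)]
    have hqt : δ * m ≤ δ * (q (e z t)).toReal := mul_le_mul_of_nonneg_left (hqm _) hδ0.le
    have hδm : 0 < δ * m := mul_pos hδ0 hm
    by_cases h : z t = e z t
    · simp only [h, ne_eq, not_true, if_false, if_true, Real.exp_zero, mul_one]
      linarith
    · simp only [h, ne_eq, not_false_eq_true, if_false, if_true, Real.exp_log hδm]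
      nlinarith
  set L := iidExp p n l with hL
  have hLval : L = -(n * klSum p q) + n * Real.log (1 - δ)
        + Real.log (δ * m) * iidExp p n (fun z => (hammingDist z (e z) : ℝ)) := by
    rw [hL, hl, iidExp_add,
      iidExp_sum_coord p n (fun a => Real.log (q a).toReal - Real.log (p a).toReal), hk, iidExp_add,
      iidExp_const, iidExp_const_mul, klSum, ← add_assoc, ← mul_neg, ← Finset.sum_neg_distrib]
    congr 3
    exact Finset.sum_congr rfl fun a _ => by ring
  rw [← hLval]
  refine le_trans ?_ (sum_prod_kernel_le_iidReal q hδ0 hδ1 n E e he)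
  refine le_trans ?_ (iidExp_mono q n hker)
  -- Jensen's inequality for `exp`, in the form of the tangent-line bound at `L`.
  have hJ : iidExp p n (fun z => Real.exp L * (1 - L) + Real.exp L * l z) = Real.exp L := by
    rw [iidExp_add, iidExp_const, iidExp_const_mul, ← hL]; ring
  rw [← hJ]
  refine Finset.sum_le_sum fun z _ => ?_
  rcases eq_or_lt_of_le (prod_toReal_nonneg p z) with h0 | h0
  · rw [← h0, zero_mul]
    exact mul_nonneg (prod_toReal_nonneg q z) (Real.exp_pos _).le
  · have hpt : ∀ t, (p (z t)).toReal ≠ 0 := by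
      intro t ht
      exact h0.ne' (Finset.prod_eq_zero (Finset.mem_univ t) ht)
    have hratio : ∏ t, (q (z t)).toReal = (∏ t, (p (z t)).toReal) *
        Real.exp (∑ t, (Real.log (q (z t)).toReal - Real.log (p (z t)).toReal)) := by
      rw [Real.exp_sum, ← Finset.prod_mul_distrib]
      refine Finset.prod_congr rfl fun t _ => ?_
      have hqt : 0 < (q (z t)).toReal := hm.trans_le (hqm _)
      rw [Real.exp_sub, Real.exp_log hqt, Real.exp_log
        (lt_of_le_of_ne ENNReal.toReal_nonneg (hpt t).symm), mul_div_cancel₀ _ (hpt t)]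
    rw [hratio, mul_assoc, ← Real.exp_add]
    refine mul_le_mul_of_nonneg_left ?_ h0.le
    have htan := Real.add_one_le_exp (l z - L)
    have : Real.exp (l z) = Real.exp L * Real.exp (l z - L) := by
      rw [← Real.exp_add]; congr 1; ring
    change _ ≤ Real.exp (l z)
    rw [this]
    refine le_trans (le_of_eq (mul_add _ _ _).symm) ?_
    exact mul_le_mul_of_nonneg_left (by linarith) (Real.exp_pos _).le

/-- Asymptotic form of the change of measure when `O(√n)` letter changes suffice on average. -/
lemma eventually_exp_le_iidReal [DecidableEq α] (p q : PMF α) (hq : ∀ a, 0 < q a) (C : ℝ)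
    {η : ℝ} (hη : 0 < η) :
    ∀ᶠ n : ℕ in atTop, ∀ (E : Set (Fin n → α)) (e : (Fin n → α) → (Fin n → α)),
      (∀ z, e z ∈ E) → iidExp p n (fun z => (hammingDist z (e z) : ℝ)) ≤ C * √n →
      Real.exp (-(n * (klSum p q + η))) ≤ iidReal q n E := by
  obtain ⟨m, hm, hm1, hqm⟩ := exists_pos_le_pmf q hq
  -- With this `δ`, the factor `(1 - δ) ^ n` costs exactly `η / 2` in the exponent.
  set δ : ℝ := 1 - Real.exp (-(η / 2)) with hδ
  have hδ0 : 0 < δ := by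
    have : Real.exp (-(η / 2)) < 1 := Real.exp_lt_one_iff.2 (by linarith)
    linarith
  have hδ1 : δ < 1 := by linarith [Real.exp_pos (-(η / 2))]
  have hlogδ : Real.log (1 - δ) = -(η / 2) := by rw [hδ, sub_sub_cancel, Real.log_exp]
  set l : ℝ := -Real.log (δ * m) with hl
  have hl0 : 0 ≤ l := by
    have : Real.log (δ * m) ≤ 0 := Real.log_nonpos (mul_pos hδ0 hm).le (by nlinarith)
    linarith
  have htend : Tendsto (fun n : ℕ => √(n : ℝ)) atTop atTop :=
    Real.tendsto_sqrt_atTop.comp tendsto_natCast_atTop_atTop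
  filter_upwards [htend.eventually_ge_atTop (l * C / (η / 2))] with n hn E e he hdist
  refine le_trans (Real.exp_le_exp.2 ?_) (exp_le_iidReal p q hm hqm hδ0 hδ1 n E e he)
  rw [hlogδ]
  have h1 : l * iidExp p n (fun z => (hammingDist z (e z) : ℝ)) ≤ l * (C * √n) :=
    mul_le_mul_of_nonneg_left hdist hl0
  have h2 : l * C ≤ √n * (η / 2) := by rwa [div_le_iff₀ (by linarith)] at hn
  have h3 : √(n : ℝ) * √n = n := Real.mul_self_sqrt (Nat.cast_nonneg n)
  have h4 : l * C * √n ≤ √n * (η / 2) * √n := mul_le_mul_of_nonneg_right h2 (Real.sqrt_nonneg _)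
  nlinarith

end ChangeOfMeasure

section ProductSets

variable {X Y₁ Y₂ : Type*} [Fintype X] [Fintype Y₁] [Fintype Y₂]

/-- Rectangles whose sides are not too unlikely under the marginals of `p` have `q`-probability of
exponent at most the relative entropy of `p` from `q`, even if they are unlikely under `p`. -/
lemma eventually_exp_le_iidReal_prod (p q : PMF (X × Y₁)) (hq : ∀ a, 0 < q a) {c η : ℝ}
    (hc : 0 < c) (hη : 0 < η) :
    ∀ᶠ n : ℕ in atTop, ∀ (A : Set (Fin n → X)) (B : Set (Fin n → Y₁)),
      c ≤ iidReal (p.map Prod.fst) n A → c ≤ iidReal (p.map Prod.snd) n B →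
      Real.exp (-(n * (klSum p q + η))) ≤
        iidReal q n {z | (fun t => (z t).1) ∈ A ∧ (fun t => (z t).2) ∈ B} := by
  classical
  filter_upwards [eventually_exp_le_iidReal p q hq (2 * √(1 / c)) hη] with n hn A B hA hB
  obtain ⟨eA, heA, hdA⟩ := exists_map_into_of_prob_ge _ n A hc hA
  obtain ⟨eB, heB, hdB⟩ := exists_map_into_of_prob_ge _ n B hc hB
  rw [iidExp_map] at hdA hdB
  refine hn _ (fun z t => (eA (fun t => (z t).1) t, eB (fun t => (z t).2) t))
    (fun z => ⟨heA _, heB _⟩) ?_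
  have hs : √((n : ℝ) / c) = √(1 / c) * √n := by
    rw [← Real.sqrt_mul (by positivity)]; congr 1; ring
  rw [hs] at hdA hdB
  refine le_trans ?_ (le_trans (add_le_add hdA hdB) (le_of_eq (by ring)))
  rw [← iidExp_add]
  refine iidExp_mono p n fun z => ?_
  simp only [hammingDist, Finset.card_filter]
  norm_cast
  rw [← Finset.sum_add_distrib]
  refine Finset.sum_le_sum fun t _ => ?_
  by_cases h1 : (z t).1 = eA (fun t => (z t).1) t <;>
    by_cases h2 : (z t).2 = eB (fun t => (z t).2) t <;> simp [Prod.ext_iff, h1, h2]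

/-- The version of `eventually_exp_le_iidReal_prod` for three factors. -/
lemma eventually_exp_le_iidReal_prod₃ (p q : PMF (X × Y₁ × Y₂)) (hq : ∀ a, 0 < q a) {c η : ℝ}
    (hc : 0 < c) (hη : 0 < η) :
    ∀ᶠ n : ℕ in atTop,
      ∀ (A : Set (Fin n → X)) (B : Set (Fin n → Y₁)) (C : Set (Fin n → Y₂)),
      c ≤ iidReal (margX p) n A → c ≤ iidReal (margY₁ p) n B → c ≤ iidReal (margY₂ p) n C →
      Real.exp (-(n * (klSum p q + η))) ≤
        iidReal q n {z | (fun t => (z t).1) ∈ A ∧ (fun t => (z t).2.1) ∈ B ∧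
          (fun t => (z t).2.2) ∈ C} := by
  classical
  filter_upwards [eventually_exp_le_iidReal p q hq (3 * √(1 / c)) hη] with n hn A B C hA hB hC
  obtain ⟨eA, heA, hdA⟩ := exists_map_into_of_prob_ge _ n A hc hA
  obtain ⟨eB, heB, hdB⟩ := exists_map_into_of_prob_ge _ n B hc hB
  obtain ⟨eC, heC, hdC⟩ := exists_map_into_of_prob_ge _ n C hc hC
  rw [margX, iidExp_map] at hdA
  rw [margY₁, iidExp_map] at hdB
  rw [margY₂, iidExp_map] at hdC
  refine hn _ (fun z t => (eA (fun t => (z t).1) t, eB (fun t => (z t).2.1) t,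
    eC (fun t => (z t).2.2) t)) (fun z => ⟨heA _, heB _, heC _⟩) ?_
  have hs : √((n : ℝ) / c) = √(1 / c) * √n := by
    rw [← Real.sqrt_mul (by positivity)]; congr 1; ring
  rw [hs] at hdA hdB hdC
  refine le_trans ?_ (le_trans (add_le_add (add_le_add hdA hdB) hdC) (le_of_eq (by ring)))
  rw [← iidExp_add, ← iidExp_add]
  refine iidExp_mono p n fun z => ?_
  simp only [hammingDist, Finset.card_filter]
  norm_cast
  rw [← Finset.sum_add_distrib, ← Finset.sum_add_distrib]
  refine Finset.sum_le_sum fun t _ => ?_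
  by_cases h1 : (z t).1 = eA (fun t => (z t).1) t <;>
    by_cases h2 : (z t).2.1 = eB (fun t => (z t).2.1) t <;>
      by_cases h3 : (z t).2.2 = eC (fun t => (z t).2.2) t <;> simp [Prod.ext_iff, h1, h2, h3]

end ProductSets

/-! ### Single-letter form of the region -/

section SingleLetter

variable {X Y₁ Y₂ : Type*} (P Pbar : PMF (X × Y₁ × Y₂))

/-- The constraints on the exponents when the sensor sends the same bit for the typical sequences of
the two hypotheses. -/
def SameBit (θ : ℝ × ℝ) : Prop :=
  ∀ π, π = margX P ∨ π = margX Pbar →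
    ENNReal.ofReal θ.1 ≤ minDiv₁ P Pbar {π} ∧ ENNReal.ofReal θ.2 ≤ minDiv₂ P Pbar {π}

/-- The constraints on the exponents when the sensor sends different bits for the typical sequences
of the two hypotheses: whichever bit is sent for the sequences of type `π`, it helps one detector
and constrains the other. -/
def DiffBit (θ : ℝ × ℝ) : Prop :=
  ENNReal.ofReal θ.2 ≤ minDiv₂ P Pbar {margX P} ∧
  ENNReal.ofReal θ.1 ≤ minDiv₁ P Pbar {margX Pbar} ∧
  ∀ π, ENNReal.ofReal θ.1 ≤ minDiv₁ P Pbar {π} ∨ ENNReal.ofReal θ.2 ≤ minDiv₂ P Pbar {π}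

variable {P Pbar}

lemma le_minDiv₁_iff {S : Set (PMF X)} {a : ℝ≥0∞} :
    a ≤ minDiv₁ P Pbar S ↔ ∀ π ∈ S, a ≤ minDiv₁ P Pbar {π} := by
  simp only [minDiv₁, le_iInf_iff, Set.mem_singleton_iff]
  exact ⟨fun h π hπ p hp hp' => h p (hp ▸ hπ) hp', fun h p hp hp' => h _ hp p rfl hp'⟩

lemma le_minDiv₂_iff {S : Set (PMF X)} {a : ℝ≥0∞} :
    a ≤ minDiv₂ P Pbar S ↔ ∀ π ∈ S, a ≤ minDiv₂ P Pbar {π} := by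
  simp only [minDiv₂, le_iInf_iff, Set.mem_singleton_iff]
  exact ⟨fun h π hπ p hp hp' => h p (hp ▸ hπ) hp', fun h p hp hp' => h _ hp p rfl hp'⟩

/-- The union over thresholds and bit assignments, described without thresholds. The threshold that
witnesses `DiffBit` is `θ₂ - θ₁`. -/
lemma exists_threshold_iff (hX : margX P ≠ margX Pbar) {θ : ℝ × ℝ} (h1 : 0 ≤ θ.1) (h2 : 0 ≤ θ.2) :
    (∃ (r : ℝ) (b : Fin 2 → Fin 2), (b = bSame ∨ b = bDiff) ∧
      ENNReal.ofReal θ.1 ≤ minDiv₁ P Pbar (Gam P Pbar b r (b 1)) ∧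
      ENNReal.ofReal θ.2 ≤ minDiv₂ P Pbar (Gam P Pbar b r (b 0))) ↔
    SameBit P Pbar θ ∨ DiffBit P Pbar θ := by
  constructor
  · rintro ⟨r, b, rfl | rfl, ha, hb⟩
    · left
      rw [le_minDiv₁_iff] at ha
      rw [le_minDiv₂_iff] at hb
      intro π hπ
      have hmem : typeIndex P Pbar bSame r π = 0 := by
        rcases hπ with rfl | rfl
        · simp [typeIndex, bSame]
        · simp [typeIndex, bSame]
      exact ⟨ha π hmem, hb π hmem⟩
    · right
      rw [le_minDiv₁_iff] at ha
      rw [le_minDiv₂_iff] at hb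
      refine ⟨hb _ ?_, ha _ ?_, fun π => ?_⟩
      · simp [Gam, typeIndex]
      · simp [Gam, typeIndex, hX.symm]
      · have hcases : ∀ i : Fin 2, i = 0 ∨ i = 1 := by decide
        rcases hcases (typeIndex P Pbar bDiff r π) with h | h
        · exact Or.inr (hb π h)
        · exact Or.inl (ha π h)
  · rintro (h | ⟨ha, hb, hc⟩)
    · refine ⟨0, bSame, Or.inl rfl, le_minDiv₁_iff.2 fun π hπ => ?_,
        le_minDiv₂_iff.2 fun π hπ => ?_⟩ <;>
      · have hπ' : π = margX P ∨ π = margX Pbar := by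
          by_contra hne
          push Not at hne
          simp [Gam, typeIndex, bSame, hne.1, hne.2] at hπ
        first | exact (h π hπ').1 | exact (h π hπ').2
    · have e1 : (θ.1 : EReal) = ((ENNReal.ofReal θ.1 : ℝ≥0∞) : EReal) := by
        rw [EReal.coe_ennreal_ofReal, max_eq_left h1]
      have e2 : (θ.2 : EReal) = ((ENNReal.ofReal θ.2 : ℝ≥0∞) : EReal) := by
        rw [EReal.coe_ennreal_ofReal, max_eq_left h2]
      have hshift : ∀ x : EReal, (θ.2 : EReal) ≤ x + ((θ.2 - θ.1 : ℝ) : EReal) ↔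
          (θ.1 : EReal) ≤ x := by
        intro x
        induction x with
        | bot => simp
        | top => rw [EReal.top_add_coe]; simp
        | coe x =>
          norm_cast
          constructor <;> intro h <;> linarith
      refine ⟨θ.2 - θ.1, bDiff, Or.inr rfl, le_minDiv₁_iff.2 fun π hπ => ?_,
        le_minDiv₂_iff.2 fun π hπ => ?_⟩
      · by_cases hp : π = margX P
        · simp [Gam, typeIndex, bDiff, hp] at hπ
        by_cases hq : π = margX Pbar
        · exact hq ▸ hb
        rcases hc π with h | h
        · exact h
        by_cases hle : (minDiv₂ P Pbar {π} : EReal)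
            ≤ (minDiv₁ P Pbar {π} : EReal) + ((θ.2 - θ.1 : ℝ) : EReal)
        · rw [← EReal.coe_ennreal_le_coe_ennreal_iff, ← e1, ← hshift]
          refine le_trans ?_ hle
          rw [e2]
          exact EReal.coe_ennreal_le_coe_ennreal_iff.2 h
        · replace hπ : typeIndex P Pbar bDiff (θ.2 - θ.1) π = 1 := hπ
          rw [typeIndex, if_neg hp, if_neg hq, if_neg (by simp [bDiff]), if_neg hle] at hπ
          simp [bDiff] at hπ
      · by_cases hp : π = margX P
        · exact hp ▸ ha
        by_cases hq : π = margX Pbar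
        · simp [Gam, typeIndex, bDiff, hq, hX.symm] at hπ
        rcases hc π with h | h
        · by_cases hle : (minDiv₂ P Pbar {π} : EReal)
              ≤ (minDiv₁ P Pbar {π} : EReal) + ((θ.2 - θ.1 : ℝ) : EReal)
          · replace hπ : typeIndex P Pbar bDiff (θ.2 - θ.1) π = 0 := hπ
            rw [typeIndex, if_neg hp, if_neg hq, if_neg (by simp [bDiff]), if_pos hle] at hπ
            simp [bDiff] at hπ
          · rw [← EReal.coe_ennreal_le_coe_ennreal_iff, ← e2]
            refine le_trans ((hshift _).2 ?_) (not_le.1 hle).le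
            rw [e1]
            exact EReal.coe_ennreal_le_coe_ennreal_iff.2 h
        · exact h

lemma isClosed_sameBit_or_diffBit :
    IsClosed {θ : ℝ × ℝ | SameBit P Pbar θ ∨ DiffBit P Pbar θ} := by
  have c1 : ∀ a : ℝ≥0∞, IsClosed {θ : ℝ × ℝ | ENNReal.ofReal θ.1 ≤ a} := fun a =>
    isClosed_le (ENNReal.continuous_ofReal.comp continuous_fst) continuous_const
  have c2 : ∀ a : ℝ≥0∞, IsClosed {θ : ℝ × ℝ | ENNReal.ofReal θ.2 ≤ a} := fun a =>
    isClosed_le (ENNReal.continuous_ofReal.comp continuous_snd) continuous_const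
  have hset : {θ : ℝ × ℝ | SameBit P Pbar θ ∨ DiffBit P Pbar θ} =
      (⋂ π, ⋂ (_ : π = margX P ∨ π = margX Pbar),
        ({θ : ℝ × ℝ | ENNReal.ofReal θ.1 ≤ minDiv₁ P Pbar {π}} ∩
          {θ : ℝ × ℝ | ENNReal.ofReal θ.2 ≤ minDiv₂ P Pbar {π}})) ∪
      ({θ : ℝ × ℝ | ENNReal.ofReal θ.2 ≤ minDiv₂ P Pbar {margX P}} ∩
        ({θ : ℝ × ℝ | ENNReal.ofReal θ.1 ≤ minDiv₁ P Pbar {margX Pbar}} ∩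
          ⋂ π, ({θ : ℝ × ℝ | ENNReal.ofReal θ.1 ≤ minDiv₁ P Pbar {π}} ∪
            {θ : ℝ × ℝ | ENNReal.ofReal θ.2 ≤ minDiv₂ P Pbar {π}}))) := by
    ext θ
    simp only [Set.mem_union, Set.mem_inter_iff, Set.mem_iInter, Set.mem_ofPred_eq, SameBit, DiffBit]
  rw [hset]
  exact (isClosed_iInter fun π => isClosed_iInter fun _ => (c1 _).inter (c2 _)).union
    ((c2 _).inter ((c1 _).inter (isClosed_iInter fun π => (c1 _).union (c2 _))))

variable [Fintype X] [Fintype Y₁]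

lemma ofReal_le_minDiv₁_singleton_iff (hP : ∀ a, 0 < margXY₁ P a) {π : PMF X} {θ : ℝ} :
    ENNReal.ofReal θ ≤ minDiv₁ P Pbar {π} ↔ ∀ p : PMF (X × Y₁), p.map Prod.fst = π →
      p.map Prod.snd = margY₁ Pbar → θ ≤ klSum p (margXY₁ P) := by
  simp only [minDiv₁, le_iInf_iff, Set.mem_singleton_iff, ofReal_le_kl_iff _ _ hP]

lemma ofReal_le_minDiv₂_singleton_iff [Fintype Y₂] (hPbar : ∀ a, 0 < Pbar a) {π : PMF X} {θ : ℝ} :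
    ENNReal.ofReal θ ≤ minDiv₂ P Pbar {π} ↔ ∀ p : PMF (X × Y₁ × Y₂), margX p = π →
      margY₁ p = margY₁ P → margY₂ p = margY₂ P → θ ≤ klSum p Pbar := by
  simp only [minDiv₂, le_iInf_iff, Set.mem_singleton_iff, ofReal_le_kl_iff _ _ hPbar]

end SingleLetter

/-! ### Upper bounds on the exponents -/

section Converse

lemma neg_log_div_le {n : ℕ} (hn : 0 < n) {d r : ℝ} (h : Real.exp (-(n * d)) ≤ r) :
    -(ENNReal.log (ENNReal.ofReal r)) / (n : EReal) ≤ (d : EReal) := by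
  rw [EReal.div_le_iff_le_mul (by exact_mod_cast hn) (EReal.natCast_ne_top n), EReal.neg_le]
  have h2 := ENNReal.log_monotone (ENNReal.ofReal_le_ofReal h)
  rw [ENNReal.log_ofReal (Real.exp _), if_neg (Real.exp_pos _).not_ge, Real.log_exp] at h2
  refine le_trans (le_of_eq ?_) h2
  norm_cast

lemma le_neg_log_div {n : ℕ} (hn : 0 < n) {d r : ℝ} (h : r ≤ Real.exp (-(n * d))) :
    (d : EReal) ≤ -(ENNReal.log (ENNReal.ofReal r)) / (n : EReal) := by
  rw [EReal.le_div_iff_mul_le (by exact_mod_cast hn) (EReal.natCast_ne_top n), EReal.le_neg]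
  have h2 := ENNReal.log_monotone (ENNReal.ofReal_le_ofReal h)
  rw [ENNReal.log_ofReal (Real.exp _), if_neg (Real.exp_pos _).not_ge, Real.log_exp] at h2
  refine h2.trans (le_of_eq ?_)
  norm_cast
  rw [mul_comm]

/-- An exponent is at most `d` if the error probability is infinitely often at least
`exp (-n (d + η))`, for every `η > 0`. -/
lemma le_of_frequently_exp_le {θ d : ℝ} {r : ℕ → ℝ}
    (hθ : (θ : EReal) ≤ liminf (fun n : ℕ =>
      -(ENNReal.log (ENNReal.ofReal (r n))) / (n : EReal)) atTop)
    (h : ∀ η > 0, ∃ᶠ n : ℕ in atTop, Real.exp (-(n * (d + η))) ≤ r n) : θ ≤ d := by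
  by_contra hlt
  push Not at hlt
  have hlt' : ((d + (θ - d) / 2 : ℝ) : EReal) < θ := by
    exact_mod_cast (by linarith : d + (θ - d) / 2 < θ)
  have hev := eventually_lt_of_lt_liminf (hlt'.trans_le hθ)
  obtain ⟨n, hn, h1, h2⟩ :=
    ((h ((θ - d) / 2) (by linarith)).and_eventually (hev.and (eventually_gt_atTop 0))).exists
  exact absurd h1 (not_lt.2 (neg_log_div_le h2 hn))

variable {X Y₁ Y₂ : Type*} [Fintype X] {W₂ n : ℕ}

/-- The message `m` of the sensor has probability at least `ε` if its observations are i.i.d.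
`π`. -/
def Code.LikelyMsg (c : Code X Y₁ Y₂ 2 W₂ n) (ε : ℝ) (π : PMF X) (m : Fin 2) : Prop :=
  ε ≤ iidReal π n {x | c.φ₁ x = m}

/-- For each sensor law, one of the two messages is likely. -/
lemma Code.likelyMsg_or (c : Code X Y₁ Y₂ 2 W₂ n) {ε : ℝ} (hε : 2 * ε ≤ 1) (π : PMF X)
    {m m' : Fin 2} (hm : m ≠ m') : c.LikelyMsg ε π m ∨ c.LikelyMsg ε π m' := by
  by_contra h
  push Not at h
  have hc : {x | c.φ₁ x = m'} = {x | c.φ₁ x = m}ᶜ := by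
    ext x
    simp only [Set.mem_ofPred_eq, Set.mem_compl_iff]
    omega
  have h1 := h.1
  have h2 := h.2
  unfold Code.LikelyMsg at h1 h2
  rw [hc, iidReal_compl] at h2
  linarith

variable [Fintype Y₁] [Fintype Y₂]

/-- After the message `m`, the block of Detector 1 makes it decide `1` with probability at least
`ε` under the marginal `ν`. -/
def Code.LikelyOne (c : Code X Y₁ Y₂ 2 W₂ n) (ε : ℝ) (ν : PMF Y₁) (m : Fin 2) : Prop :=
  ε ≤ iidReal ν n {y | c.ψ₁ m y = 1}

/-- After the message `m` of the sensor, some message of Detector 1 has probability at least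
`ε` under the marginal `ν₁`, and makes Detector 2 decide `0` with probability at least `ε` under
the marginal `ν₂`. -/
def Code.LikelyZero (c : Code X Y₁ Y₂ 2 W₂ n) (ε : ℝ) (ν₁ : PMF Y₁) (ν₂ : PMF Y₂)
    (m : Fin 2) : Prop :=
  ∃ m₂, ε ≤ iidReal ν₁ n {y | c.φ₂ m y = m₂} ∧ ε ≤ iidReal ν₂ n {y | c.ψ₂ m m₂ y = 0}

lemma exists_ge_of_card_mul_le {ι α : Type*} [Fintype ι] [Fintype α] (p : PMF α)
    (E : ι → Set (Fin n → α)) {F : Set (Fin n → α)} (hF : F ⊆ ⋃ i, E i) {ε : ℝ}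
    (hε : Fintype.card ι * ε < iidReal p n F) : ∃ i, ε ≤ iidReal p n (E i) := by
  by_contra h
  push Not at h
  have h1 := (iidReal_mono p n hF).trans (iidReal_iUnion_le p n E)
  have h2 : ∑ i, iidReal p n (E i) ≤ ∑ _i : ι, ε := Finset.sum_le_sum fun i _ => (h i).le
  simp only [Finset.sum_const, Finset.card_univ, nsmul_eq_mul] at h2
  linarith

lemma half_lt_iidReal_of_compl {α : Type*} [Fintype α] (p : PMF α) {E F : Set (Fin n → α)}
    (hE : Eᶜ = F) (h : iidProb p n E < ENNReal.ofReal (1 / 2)) : 1 / 2 < iidReal p n F := by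
  rw [iidProb_eq_ofReal, ENNReal.ofReal_lt_ofReal_iff (by norm_num)] at h
  rw [← hE, iidReal_compl]
  linarith

lemma fin_two_ne_one_iff (i : Fin 2) : ¬ i = 1 ↔ i = 0 := by omega

lemma fin_two_ne_zero_iff (i : Fin 2) : ¬ i = 0 ↔ i = 1 := by omega

/-- If Detector 1 is reliable under the law `Pbar`, a message is likely under it after which
Detector 1 is likely to decide `1`. -/
lemma Code.exists_likelyMsg_likelyOne (c : Code X Y₁ Y₂ 2 W₂ n) (P Pbar : PMF (X × Y₁ × Y₂))
    {ε : ℝ} (hε : 4 * ε ≤ 1) (h : c.prob₁ P Pbar 0 1 < ENNReal.ofReal (1 / 2)) :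
    ∃ m, c.LikelyMsg ε (margX Pbar) m ∧ c.LikelyOne ε (margY₁ Pbar) m := by
  have h1 : 1 / 2 < iidReal Pbar n {z | c.decision₁ z = 1} :=
    half_lt_iidReal_of_compl _ (by ext z; simp [fin_two_ne_zero_iff]) h
  obtain ⟨m, hm⟩ := exists_ge_of_card_mul_le (ε := ε)
    (F := {z | c.decision₁ z = 1}) Pbar
    (fun m : Fin 2 => {z | c.φ₁ (fun t => (z t).1) = m ∧ c.ψ₁ m (fun t => (z t).2.1) = 1})
    (fun z hz => Set.mem_iUnion.2 ⟨_, rfl, hz⟩) (by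
      rw [Fintype.card_fin]; push_cast; linarith)
  refine ⟨m, ?_, ?_⟩
  · rw [Code.LikelyMsg, margX, iidReal_map]
    exact hm.trans (iidReal_mono _ _ fun z hz => hz.1)
  · rw [Code.LikelyOne, margY₁, iidReal_map]
    exact hm.trans (iidReal_mono _ _ fun z hz => hz.2)

/-- If Detector 2 is reliable under the law `P`, a pair of messages is likely under it after which
Detector 2 is likely to decide `0`. -/
lemma Code.exists_likelyMsg_likelyZero (c : Code X Y₁ Y₂ 2 W₂ n) (P Pbar : PMF (X × Y₁ × Y₂))
    {ε : ℝ} (hε : 4 * W₂ * ε ≤ 1) (h : c.prob₂ P Pbar 1 0 < ENNReal.ofReal (1 / 2)) :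
    ∃ m, c.LikelyMsg ε (margX P) m ∧ c.LikelyZero ε (margY₁ P) (margY₂ P) m := by
  have h1 : 1 / 2 < iidReal P n {z | c.decision₂ z = 0} :=
    half_lt_iidReal_of_compl _ (by ext z; simp [fin_two_ne_one_iff]) h
  obtain ⟨⟨m, m₂⟩, hm⟩ := exists_ge_of_card_mul_le (ε := ε)
    (F := {z | c.decision₂ z = 0}) P
    (fun m : Fin 2 × Fin W₂ => {z | c.φ₁ (fun t => (z t).1) = m.1 ∧
      c.φ₂ m.1 (fun t => (z t).2.1) = m.2 ∧ c.ψ₂ m.1 m.2 (fun t => (z t).2.2) = 0})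
    (fun z hz => Set.mem_iUnion.2 ⟨(_, _), rfl, rfl, hz⟩) (by
      rw [Fintype.card_prod, Fintype.card_fin, Fintype.card_fin]; push_cast; linarith)
  refine ⟨m, ?_, m₂, ?_, ?_⟩
  · rw [Code.LikelyMsg, margX, iidReal_map]
    exact hm.trans (iidReal_mono _ _ fun z hz => hz.1)
  · rw [margY₁, iidReal_map]
    exact hm.trans (iidReal_mono _ _ fun z hz => hz.2.1)
  · rw [margY₂, iidReal_map]
    exact hm.trans (iidReal_mono _ _ fun z hz => hz.2.2)

variable {P Pbar : PMF (X × Y₁ × Y₂)} {c : ∀ n : ℕ, Code X Y₁ Y₂ 2 W₂ n}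

/-- The exponent of Detector 1 is bounded by the divergence of every sensor law `π` for which,
infinitely often, a message that lets Detector 1 decide `1` is likely. -/
lemma le_minDiv₁_of_frequently (hP : ∀ a, 0 < margXY₁ P a) {θ : ℝ}
    (hθ : (θ : EReal) ≤ liminf (fun n : ℕ =>
      -(ENNReal.log ((c n).prob₁ P Pbar 1 0)) / (n : EReal)) atTop)
    {ε : ℝ} (hε : 0 < ε) {π : PMF X}
    (h : ∃ᶠ n in atTop, ∃ m, (c n).LikelyMsg ε π m ∧ (c n).LikelyOne ε (margY₁ Pbar) m) :
    ENNReal.ofReal θ ≤ minDiv₁ P Pbar {π} := by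
  rw [ofReal_le_minDiv₁_singleton_iff hP]
  intro p hp1 hp2
  simp only [Code.prob₁, iidProb_eq_ofReal] at hθ
  refine le_of_frequently_exp_le hθ fun η hη => ?_
  refine (h.and_eventually (eventually_exp_le_iidReal_prod p _ hP hε hη)).mono ?_
  rintro n ⟨⟨m, hm, hm1⟩, hn⟩
  refine (hn {x | (c n).φ₁ x = m} {y | (c n).ψ₁ m y = 1} (by rwa [hp1]) (by rwa [hp2])).trans ?_
  rw [margXY₁, iidReal_map]
  refine iidReal_mono _ _ ?_
  rintro z ⟨h1, h2⟩
  simp only [Set.mem_ofPred_eq] at h1 h2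
  simp [Code.decision₁, h1, h2]

/-- The exponent of Detector 2 is bounded by the divergence of every sensor law `π` for which,
infinitely often, a message that lets Detector 2 decide `0` is likely. -/
lemma le_minDiv₂_of_frequently (hPbar : ∀ a, 0 < Pbar a) {θ : ℝ}
    (hθ : (θ : EReal) ≤ liminf (fun n : ℕ =>
      -(ENNReal.log ((c n).prob₂ P Pbar 0 1)) / (n : EReal)) atTop)
    {ε : ℝ} (hε : 0 < ε) {π : PMF X}
    (h : ∃ᶠ n in atTop, ∃ m, (c n).LikelyMsg ε π m ∧
      (c n).LikelyZero ε (margY₁ P) (margY₂ P) m) :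
    ENNReal.ofReal θ ≤ minDiv₂ P Pbar {π} := by
  rw [ofReal_le_minDiv₂_singleton_iff hPbar]
  intro p hp hp1 hp2
  simp only [Code.prob₂, iidProb_eq_ofReal] at hθ
  refine le_of_frequently_exp_le hθ fun η hη => ?_
  refine (h.and_eventually (eventually_exp_le_iidReal_prod₃ p _ hPbar hε hη)).mono ?_
  rintro n ⟨⟨m, hm, m₂, hm1, hm2⟩, hn⟩
  refine (hn {x | (c n).φ₁ x = m} {y | (c n).φ₂ m y = m₂} {y | (c n).ψ₂ m m₂ y = 0}
    (by rwa [hp]) (by rwa [hp1]) (by rwa [hp2])).trans ?_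
  refine iidReal_mono _ _ ?_
  rintro z ⟨h1, h2, h3⟩
  simp only [Set.mem_ofPred_eq] at h1 h2 h3
  simp [Code.decision₂, h1, h2, h3]

/-- Achievable exponents satisfy the single-letter constraints. The messages that are likely under
the two hypotheses coincide infinitely often or differ infinitely often. -/
lemma sameBit_or_diffBit_of_achievable (hP : ∀ a, 0 < margXY₁ P a) (hPbar : ∀ a, 0 < Pbar a)
    (hW₂ : 0 < W₂) {θ : ℝ × ℝ} (h : Achievable P Pbar 0 2 W₂ θ) :
    SameBit P Pbar θ ∨ DiffBit P Pbar θ := by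
  obtain ⟨-, -, c, hα1, hα2, hβ1, hβ2⟩ := h
  have hWpos : (1 : ℝ) ≤ W₂ := by exact_mod_cast hW₂
  set ε : ℝ := 1 / (4 * W₂) with hεdef
  have hε : 0 < ε := by positivity
  have hε2 : 4 * W₂ * ε ≤ 1 := le_of_eq (by rw [hεdef]; field_simp)
  have hε1 : 4 * ε ≤ 1 := by nlinarith
  have hhalf : (0 : ℝ≥0∞) < ENNReal.ofReal (1 / 2) := by simp
  have hev1 := eventually_lt_of_limsup_lt (hα1.trans_lt hhalf)
  have hev2 := eventually_lt_of_limsup_lt (hα2.trans_lt hhalf)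
  have hmsg : ∀ᶠ n in atTop, ∃ m m',
      ((c n).LikelyMsg ε (margX P) m ∧ (c n).LikelyZero ε (margY₁ P) (margY₂ P) m) ∧
      ((c n).LikelyMsg ε (margX Pbar) m' ∧ (c n).LikelyOne ε (margY₁ Pbar) m') := by
    filter_upwards [hev1, hev2] with n h1 h2
    obtain ⟨m, hm⟩ := (c n).exists_likelyMsg_likelyZero P Pbar hε2 h2
    obtain ⟨m', hm'⟩ := (c n).exists_likelyMsg_likelyOne P Pbar hε1 h1
    exact ⟨m, m', hm, hm'⟩
  have hsplit : (∃ᶠ n in atTop, ∃ m,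
      ((c n).LikelyMsg ε (margX P) m ∧ (c n).LikelyZero ε (margY₁ P) (margY₂ P) m) ∧
      ((c n).LikelyMsg ε (margX Pbar) m ∧ (c n).LikelyOne ε (margY₁ Pbar) m)) ∨
      (∃ᶠ n in atTop, ∃ m m', m ≠ m' ∧
      ((c n).LikelyMsg ε (margX P) m ∧ (c n).LikelyZero ε (margY₁ P) (margY₂ P) m) ∧
      ((c n).LikelyMsg ε (margX Pbar) m' ∧ (c n).LikelyOne ε (margY₁ Pbar) m')) := by
    rw [← frequently_or_distrib]
    refine (hmsg.mono ?_).frequently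
    rintro n ⟨m, m', hm, hm'⟩
    rcases eq_or_ne m m' with rfl | hne
    · exact Or.inl ⟨m, hm, hm'⟩
    · exact Or.inr ⟨m, m', hne, hm, hm'⟩
  rcases hsplit with hf | hf
  · left
    rintro π (rfl | rfl)
    · exact ⟨le_minDiv₁_of_frequently hP hβ1 hε
          (hf.mono fun n ⟨m, h1, h2⟩ => ⟨m, h1.1, h2.2⟩),
        le_minDiv₂_of_frequently hPbar hβ2 hε (hf.mono fun n ⟨m, h1, h2⟩ => ⟨m, h1⟩)⟩
    · exact ⟨le_minDiv₁_of_frequently hP hβ1 hε (hf.mono fun n ⟨m, h1, h2⟩ => ⟨m, h2⟩),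
        le_minDiv₂_of_frequently hPbar hβ2 hε (hf.mono fun n ⟨m, h1, h2⟩ => ⟨m, h2.1, h1.2⟩)⟩
  · right
    refine ⟨le_minDiv₂_of_frequently hPbar hβ2 hε
        (hf.mono fun n ⟨m, m', _, h1, h2⟩ => ⟨m, h1⟩),
      le_minDiv₁_of_frequently hP hβ1 hε (hf.mono fun n ⟨m, m', _, h1, h2⟩ => ⟨m', h2⟩),
      fun π => ?_⟩
    have hπ : (∃ᶠ n in atTop, ∃ m, (c n).LikelyMsg ε π m ∧
          (c n).LikelyOne ε (margY₁ Pbar) m) ∨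
        (∃ᶠ n in atTop, ∃ m, (c n).LikelyMsg ε π m ∧
          (c n).LikelyZero ε (margY₁ P) (margY₂ P) m) := by
      rw [← frequently_or_distrib]
      refine hf.mono ?_
      rintro n ⟨m, m', hne, h1, h2⟩
      rcases (c n).likelyMsg_or (by linarith) π hne with hl | hl
      · exact Or.inr ⟨m, hl, h1.2⟩
      · exact Or.inl ⟨m', hl, h2.2⟩
    exact hπ.imp (le_minDiv₁_of_frequently hP hβ1 hε) (le_minDiv₂_of_frequently hPbar hβ2 hε)

end Converse

/-! ### Types -/

section Types

variable {α β : Type*}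

/-- The type (empirical distribution) of a nonempty block. -/
noncomputable def empPMF {n : ℕ} [NeZero n] (z : Fin n → α) : PMF α :=
  (PMF.uniformOfFintype (Fin n)).map z

lemma map_empPMF {n : ℕ} [NeZero n] (z : Fin n → α) (g : α → β) :
    (empPMF z).map g = empPMF (fun t => g (z t)) := by
  rw [empPMF, PMF.map_comp]; rfl

lemma pmf_ext_toReal {p q : PMF α} (h : ∀ a, (p a).toReal = (q a).toReal) : p = q :=
  PMF.ext fun a => (ENNReal.toReal_eq_toReal_iff' (p.apply_ne_top a) (q.apply_ne_top a)).1 (h a)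

variable [Fintype α] [Fintype β]

lemma mul_sum_empPMF {n : ℕ} [NeZero n] (z : Fin n → α) (h : α → ℝ) :
    n * ∑ a, (empPMF z a).toReal * h a = ∑ t, h (z t) := by
  have hn : (n : ℝ) ≠ 0 := Nat.cast_ne_zero.2 (NeZero.ne n)
  rw [empPMF, sum_toReal_map, Finset.mul_sum]
  refine Finset.sum_congr rfl fun t _ => ?_
  simp [PMF.uniformOfFintype_apply, hn]

lemma mul_empPMF_apply [DecidableEq α] {n : ℕ} [NeZero n] (z : Fin n → α) (a : α) :
    n * (empPMF z a).toReal = ∑ t, if z t = a then (1 : ℝ) else 0 := by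
  rw [← mul_sum_empPMF z fun b => if b = a then (1 : ℝ) else 0]
  simp

lemma empPMF_apply_pos {n : ℕ} [NeZero n] (z : Fin n → α) (t : Fin n) :
    0 < (empPMF z (z t)).toReal := by
  classical
  have h := mul_empPMF_apply z (z t)
  have h1 : 0 < ∑ s, if z s = z t then (1 : ℝ) else 0 :=
    Finset.sum_pos' (fun s _ => by split_ifs <;> norm_num) ⟨t, Finset.mem_univ t, by simp⟩
  rw [← h] at h1
  exact pos_of_mul_pos_right h1 (Nat.cast_nonneg n)

/-- The probability of a block is its probability under its own type, discounted by the relative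
entropy of the type. -/
lemma prod_eq_exp_mul_prod_empPMF {n : ℕ} [NeZero n] (q : PMF α) (hq : ∀ a, 0 < q a)
    (z : Fin n → α) : ∏ t, (q (z t)).toReal =
      Real.exp (-(n * klSum (empPMF z) q)) * ∏ t, (empPMF z (z t)).toReal := by
  rw [klSum, mul_sum_empPMF z (fun a => Real.log (empPMF z a).toReal - Real.log (q a).toReal),
    ← Finset.sum_neg_distrib, Real.exp_sum, ← Finset.prod_mul_distrib]
  refine Finset.prod_congr rfl fun t _ => ?_
  have h1 := empPMF_apply_pos z t
  have h2 : 0 < (q (z t)).toReal := ENNReal.toReal_pos (hq _).ne' (q.apply_ne_top _)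
  rw [neg_sub, Real.exp_sub, Real.exp_log h2, Real.exp_log h1, div_mul_cancel₀ _ h1.ne']

/-- The type of a block is a function of its letter counts, of which there are at most
`(n + 1) ^ |α|`. -/
lemma exists_empPMF_eq_of_counts (n : ℕ) [NeZero n] (q : PMF α) :
    ∃ (T : (α → Fin (n + 1)) → PMF α) (k : (Fin n → α) → α → Fin (n + 1)),
      ∀ z, empPMF z = T (k z) := by
  classical
  let k : (Fin n → α) → α → Fin (n + 1) := fun z a =>
    ⟨(Finset.univ.filter fun t => z t = a).card,
      Nat.lt_succ_of_le ((Finset.card_le_univ _).trans (by simp))⟩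
  have hk : Function.FactorsThrough (fun z : Fin n → α => empPMF z) k := by
    intro z z' h
    refine pmf_ext_toReal fun a => ?_
    have hn : (n : ℝ) ≠ 0 := Nat.cast_ne_zero.2 (NeZero.ne n)
    refine mul_left_cancel₀ hn ?_
    rw [mul_empPMF_apply, mul_empPMF_apply]
    have := congrArg Fin.val (congrFun h a)
    simp only [k] at this
    simp only [Finset.sum_boole, this]
  exact ⟨Function.extend k (fun z => empPMF z) fun _ => q, k, fun z => (hk.extend_apply _ z).symm⟩

/-- Sanov's bound: an event all of whose blocks have types of relative entropy at least `d` from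
`q` has probability at most `exp (-n d)`, up to the number of types. -/
lemma iidReal_le_of_le_klSum {n : ℕ} [NeZero n] (q : PMF α) (hq : ∀ a, 0 < q a)
    (E : Set (Fin n → α)) {d : ℝ} (hE : ∀ z ∈ E, d ≤ klSum (empPMF z) q) :
    iidReal q n E ≤ ((n : ℝ) + 1) ^ Fintype.card α * Real.exp (-(n * d)) := by
  classical
  obtain ⟨T, k, hTk⟩ := exists_empPMF_eq_of_counts n q
  have hz : ∀ z, (∏ t, (q (z t)).toReal) * E.indicator (fun _ => (1 : ℝ)) z ≤
      Real.exp (-(n * d)) * ∑ i, ∏ t, (T i (z t)).toReal := by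
    intro z
    have hnn : 0 ≤ ∑ i, ∏ t, (T i (z t)).toReal :=
      Finset.sum_nonneg fun i _ => prod_toReal_nonneg _ _
    by_cases h : z ∈ E
    · rw [Set.indicator_of_mem h, mul_one, prod_eq_exp_mul_prod_empPMF q hq]
      refine mul_le_mul (Real.exp_le_exp.2 ?_) ?_ (prod_toReal_nonneg _ _) (Real.exp_pos _).le
      · have := mul_le_mul_of_nonneg_left (hE z h) (Nat.cast_nonneg (α := ℝ) n)
        linarith
      · rw [hTk z]
        exact Finset.single_le_sum (f := fun i => ∏ t, (T i (z t)).toReal)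
          (fun i _ => prod_toReal_nonneg _ _) (Finset.mem_univ (k z))
    · rw [Set.indicator_of_notMem h, mul_zero]
      exact mul_nonneg (Real.exp_pos _).le hnn
  have h1 : ∀ i, ∑ z : Fin n → α, ∏ t, (T i (z t)).toReal = 1 := by
    intro i
    refine Eq.trans (Finset.sum_congr rfl fun z _ => ?_) (iidExp_const (T i) n 1)
    rw [mul_one]
  have h2 : iidReal q n E ≤ ∑ z : Fin n → α, Real.exp (-(n * d)) * ∑ i, ∏ t, (T i (z t)).toReal :=
    Finset.sum_le_sum fun z _ => hz z
  refine h2.trans (le_of_eq ?_)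
  rw [← Finset.mul_sum, Finset.sum_comm, Finset.sum_congr rfl fun i _ => h1 i, mul_comm,
    Finset.sum_const, Finset.card_univ, Fintype.card_fun, Fintype.card_fin, nsmul_eq_mul, mul_one,
    Nat.cast_pow, Nat.cast_succ]

end Types

/-! ### Typical neighbourhoods -/

section Near

variable {α β γ : Type*}

/-- The pmf `τ` is in the neighbourhood of `ν` with parameter `t`: `ν` is a mixture of `τ`, with
weight `1 - t`, and some other pmf. In contrast to a ball, such a neighbourhood does not contain
any `τ` that charges a letter outside the support of `ν`. -/
def Near (t : ℝ) (ν τ : PMF α) : Prop :=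
  ∀ a, (1 - t) * (τ a).toReal ≤ (ν a).toReal

lemma near_self {t : ℝ} (ht : 0 ≤ t) (ν : PMF α) : Near t ν ν := fun a => by
  nlinarith [ENNReal.toReal_nonneg (a := ν a)]

variable [Fintype α] [Fintype β] [Fintype γ]

lemma exists_pmf_toReal_eq (f : α → ℝ) (h0 : ∀ a, 0 ≤ f a) (h1 : ∑ a, f a = 1) :
    ∃ p : PMF α, ∀ a, (p a).toReal = f a := by
  refine ⟨PMF.ofFintype (fun a => ENNReal.ofReal (f a)) ?_, fun a => ?_⟩
  · rw [← ENNReal.ofReal_sum_of_nonneg fun a _ => h0 a, h1, ENNReal.ofReal_one]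
  · rw [PMF.ofFintype_apply, ENNReal.toReal_ofReal (h0 a)]

lemma exists_mix (p ρ : PMF α) {t : ℝ} (ht0 : 0 ≤ t) (ht1 : t ≤ 1) :
    ∃ p' : PMF α, ∀ a, (p' a).toReal = (1 - t) * (p a).toReal + t * (ρ a).toReal := by
  refine exists_pmf_toReal_eq _ (fun a => ?_) ?_
  · exact add_nonneg (mul_nonneg (by linarith) ENNReal.toReal_nonneg)
      (mul_nonneg ht0 ENNReal.toReal_nonneg)
  · rw [Finset.sum_add_distrib, ← Finset.mul_sum, ← Finset.mul_sum, sum_toReal_pmf,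
      sum_toReal_pmf]
    ring

lemma map_mix {p p' ρ : PMF α} {t : ℝ}
    (h : ∀ a, (p' a).toReal = (1 - t) * (p a).toReal + t * (ρ a).toReal) (g : α → β) (b : β) :
    ((p'.map g) b).toReal = (1 - t) * ((p.map g) b).toReal + t * ((ρ.map g) b).toReal := by
  classical
  have key : ∀ q : PMF α, ((q.map g) b).toReal
      = ∑ a, (q a).toReal * if g a = b then 1 else 0 := by
    intro q
    rw [← sum_toReal_map q g fun c => if c = b then 1 else 0]
    simp
  rw [key, key, key, Finset.mul_sum, Finset.mul_sum, ← Finset.sum_add_distrib]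
  exact Finset.sum_congr rfl fun a _ => by rw [h a]; ring

lemma Near.exists_residual {t : ℝ} (ht : 0 < t) {ν τ : PMF α} (h : Near t ν τ) :
    ∃ ρ : PMF α, ∀ a, (ν a).toReal = (1 - t) * (τ a).toReal + t * (ρ a).toReal := by
  obtain ⟨ρ, hρ⟩ := exists_pmf_toReal_eq (fun a => ((ν a).toReal - (1 - t) * (τ a).toReal) / t)
    (fun a => div_nonneg (sub_nonneg.2 (h a)) ht.le) (by
      rw [← Finset.sum_div, Finset.sum_sub_distrib, ← Finset.mul_sum, sum_toReal_pmf,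
        sum_toReal_pmf]
      field_simp; ring)
  refine ⟨ρ, fun a => ?_⟩
  rw [hρ a]
  field_simp; ring

lemma exists_pmf_prod {α β : Type*} (p : PMF α) (q : PMF β) :
    ∃ r : PMF (α × β), r.map Prod.fst = p ∧ r.map Prod.snd = q := by
  refine ⟨p.bind fun a => q.map fun b => (a, b), ?_, ?_⟩
  · rw [PMF.map_bind]
    have : ∀ a : α, (q.map fun b => (a, b)).map Prod.fst = PMF.pure a := fun a => by
      rw [PMF.map_comp]; exact PMF.map_const _ _
    simp only [this, PMF.bind_pure]
  · rw [PMF.map_bind]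
    have : ∀ a : α, (q.map fun b => (a, b)).map Prod.snd = q := fun a => by
      rw [PMF.map_comp]; exact PMF.map_id _
    simp only [this, PMF.bind_const]

/-- Mixing `p` with any pmf, which gets the weight `t`, raises the relative entropy from `q` by at
most `-t log m`. -/
lemma klSum_mix_le {p p' ρ q : PMF α} (hq : ∀ a, 0 < q a) {m t : ℝ} (hm : 0 < m)
    (hqm : ∀ a, m ≤ (q a).toReal) (ht0 : 0 ≤ t) (ht1 : t ≤ 1)
    (h : ∀ a, (p' a).toReal = (1 - t) * (p a).toReal + t * (ρ a).toReal) :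
    klSum p' q ≤ klSum p q + t * -Real.log m := by
  have h1 := klSum_le_of_mix (q := q) ht0 ht1 h
  have h2 := mul_le_mul_of_nonneg_left (klSum_le_neg_log (p := ρ) hm hqm) ht0
  have h3 := mul_nonneg ht0 (klSum_nonneg p q hq)
  linarith

/-- A pmf on a product with marginals near `ν` and `ν₁` can be given exactly these marginals at a
small cost in relative entropy. -/
lemma exists_marginals_eq {p q : PMF (α × β)} (hq : ∀ a, 0 < q a) {m t : ℝ} (hm : 0 < m)
    (hqm : ∀ a, m ≤ (q a).toReal) (ht0 : 0 < t) (ht1 : t ≤ 1) {ν : PMF α} {ν₁ : PMF β}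
    (h : Near t ν (p.map Prod.fst)) (h₁ : Near t ν₁ (p.map Prod.snd)) :
    ∃ p' : PMF (α × β), p'.map Prod.fst = ν ∧ p'.map Prod.snd = ν₁ ∧
      klSum p' q ≤ klSum p q + t * -Real.log m := by
  obtain ⟨ρ, hρ⟩ := h.exists_residual ht0
  obtain ⟨ρ₁, hρ₁⟩ := h₁.exists_residual ht0
  obtain ⟨r, rfl, rfl⟩ := exists_pmf_prod ρ ρ₁
  obtain ⟨p', hp'⟩ := exists_mix p r ht0.le ht1
  exact ⟨p', pmf_ext_toReal fun a => by rw [map_mix hp', hρ],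
    pmf_ext_toReal fun a => by rw [map_mix hp', hρ₁], klSum_mix_le hq hm hqm ht0.le ht1 hp'⟩

/-- The version of `exists_marginals_eq` for three factors. -/
lemma exists_marginals_eq₃ {p q : PMF (α × β × γ)} (hq : ∀ a, 0 < q a) {m t : ℝ} (hm : 0 < m)
    (hqm : ∀ a, m ≤ (q a).toReal) (ht0 : 0 < t) (ht1 : t ≤ 1)
    {ν : PMF α} {ν₁ : PMF β} {ν₂ : PMF γ}
    (h : Near t ν (margX p)) (h₁ : Near t ν₁ (margY₁ p)) (h₂ : Near t ν₂ (margY₂ p)) :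
    ∃ p' : PMF (α × β × γ), margX p' = ν ∧ margY₁ p' = ν₁ ∧ margY₂ p' = ν₂ ∧
      klSum p' q ≤ klSum p q + t * -Real.log m := by
  obtain ⟨ρ, hρ⟩ := h.exists_residual ht0
  obtain ⟨ρ₁, hρ₁⟩ := h₁.exists_residual ht0
  obtain ⟨ρ₂, hρ₂⟩ := h₂.exists_residual ht0
  obtain ⟨s, hs₁, hs₂⟩ := exists_pmf_prod ρ₁ ρ₂
  obtain ⟨r, hr, hrs⟩ := exists_pmf_prod ρ s
  have hr1 : r.map (fun z => z.2.1) = ρ₁ := by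
    rw [← hs₁, ← hrs, PMF.map_comp]; rfl
  have hr2 : r.map (fun z => z.2.2) = ρ₂ := by
    rw [← hs₂, ← hrs, PMF.map_comp]; rfl
  obtain ⟨p', hp'⟩ := exists_mix p r ht0.le ht1
  refine ⟨p', pmf_ext_toReal fun a => ?_, pmf_ext_toReal fun a => ?_, pmf_ext_toReal fun a => ?_,
    klSum_mix_le hq hm hqm ht0.le ht1 hp'⟩
  · rw [margX, map_mix hp', hρ, ← hr]; rfl
  · rw [margY₁, map_mix hp', hρ₁, ← hr1]; rfl
  · rw [margY₂, map_mix hp', hρ₂, ← hr2]; rfl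

/-- Neighbourhoods of different pmfs are disjoint when their parameter is small. -/
lemma exists_not_near_of_ne {p q : PMF α} (h : p ≠ q) :
    ∃ t₀ : ℝ, 0 < t₀ ∧ ∀ t < t₀, ∀ τ, Near t p τ → ¬ Near t q τ := by
  classical
  have hex : ∃ a, (p a).toReal < (q a).toReal := by
    by_contra hle
    push Not at hle
    have := (Finset.sum_eq_sum_iff_of_le fun a (_ : a ∈ Finset.univ) => hle a).1
      (by rw [sum_toReal_pmf, sum_toReal_pmf])
    exact h (pmf_ext_toReal fun a => (this a (Finset.mem_univ a)).symm)
  obtain ⟨a, ha⟩ := hex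
  refine ⟨(q a).toReal - (p a).toReal, sub_pos.2 ha, fun t ht τ hp hq => ?_⟩
  have h1 : ∑ b, (1 - t) * (τ b).toReal ≤
      ∑ b, ((q b).toReal - if b = a then (q a).toReal - (p a).toReal else 0) := by
    refine Finset.sum_le_sum fun b _ => ?_
    split_ifs with hb
    · subst hb; linarith [hp b]
    · linarith [hq b]
  rw [← Finset.mul_sum, Finset.sum_sub_distrib, sum_toReal_pmf, sum_toReal_pmf] at h1
  simp at h1
  linarith

/-- The weak law of large numbers, with a rate: the type of an i.i.d. block is near its law. -/
lemma exists_iidReal_not_near_le (ν : PMF α) {t : ℝ} (ht0 : 0 < t) :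
    ∃ C : ℝ, ∀ (n : ℕ) [NeZero n], iidReal ν n {z | ¬ Near t ν (empPMF z)} ≤ C / n := by
  classical
  refine ⟨∑ a, 1 / (t * (ν a).toReal) ^ 2, fun n _ => ?_⟩
  have hn : (0 : ℝ) < n := Nat.cast_pos.2 (NeZero.pos n)
  have hsub : {z : Fin n → α | ¬ Near t ν (empPMF z)} ⊆
      ⋃ a, {z | (ν a).toReal < (1 - t) * (empPMF z a).toReal} := by
    intro z hz
    simpa [Near] using hz
  refine (iidReal_mono ν n hsub).trans ((iidReal_iUnion_le ν n _).trans ?_)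
  rw [Finset.sum_div]
  refine Finset.sum_le_sum fun a _ => ?_
  rcases eq_or_lt_of_le (ENNReal.toReal_nonneg (a := ν a)) with h0 | h0
  -- A letter outside the support of `ν` almost surely does not occur in the block.
  · have : iidReal ν n {z | (ν a).toReal < (1 - t) * (empPMF z a).toReal} = 0 := by
      refine Finset.sum_eq_zero fun z _ => ?_
      by_cases hz : ∃ s, z s = a
      · obtain ⟨s, hs⟩ := hz
        rw [Finset.prod_eq_zero (Finset.mem_univ s) (by rw [hs, ← h0]), zero_mul]
      · push Not at hz
        have h1 := mul_empPMF_apply z a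
        simp only [hz, if_false, Finset.sum_const_zero] at h1
        have h2 : (empPMF z a).toReal = 0 := by
          rcases mul_eq_zero.1 h1 with h | h
          · exact absurd h hn.ne'
          · exact h
        rw [Set.indicator_of_notMem, mul_zero]
        simp [h2, ← h0]
    rw [this]
    positivity
  · set f : (Fin n → α) → ℝ := fun z => ∑ s, if z s = a then (1 : ℝ) else 0 with hf
    have hEf : iidExp ν n f = n * (ν a).toReal := by
      rw [hf, iidExp_sum_coord ν n fun b => if b = a then (1 : ℝ) else 0]
      simp
    have hlip : ∀ z z', |f z - f z'| ≤ hammingDist z z' := by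
      intro z z'
      simp only [hf]
      rw [← Finset.sum_sub_distrib]
      refine (Finset.abs_sum_le_sum_abs _ _).trans ?_
      simp only [hammingDist, Finset.card_filter, Nat.cast_sum]
      refine Finset.sum_le_sum fun s _ => ?_
      by_cases hs : z s = z' s
      · simp [hs]
      · simp only [ne_eq, hs, not_false_eq_true, if_true, Nat.cast_one]
        split_ifs <;> norm_num
    have hch := iidReal_chebyshev ν n f hlip
      {z | (ν a).toReal < (1 - t) * (empPMF z a).toReal} ((n * (t * (ν a).toReal)) ^ 2)
      fun z hz => by
        have hz' : (ν a).toReal < (1 - t) * (empPMF z a).toReal := hz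
        have hfz : f z = n * (empPMF z a).toReal := (mul_empPMF_apply z a).symm
        rw [hEf, hfz, ← mul_sub]
        have hpos : 0 ≤ (empPMF z a).toReal := ENNReal.toReal_nonneg
        have h1 : (ν a).toReal ≤ (empPMF z a).toReal := by nlinarith
        have h2 : t * (ν a).toReal ≤ (empPMF z a).toReal - (ν a).toReal := by nlinarith
        have h3 : 0 ≤ t * (ν a).toReal := by positivity
        exact pow_le_pow_left₀ (by positivity) (mul_le_mul_of_nonneg_left h2 hn.le) 2
    have hpos : 0 < t * (ν a).toReal := mul_pos ht0 h0
    rw [le_div_iff₀ hn, le_div_iff₀ (by positivity)]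
    rw [mul_pow] at hch
    nlinarith

end Near

/-! ### Construction of schemes -/

section Direct

variable {X Y₁ Y₂ : Type*} [Fintype X] [Fintype Y₁] [Fintype Y₂] {P Pbar : PMF (X × Y₁ × Y₂)}

open Classical in
/-- The scheme of a rule `s` that maps types of the sensor block to bits. Detector 1 decides `1`
after the bit `m₁` if its own type is near its law under `Pbar`, and reports whether its type is
near its law under `P`. Detector 2 decides `0` after the bit `m₀` if this report is positive and its
own type is near its law under `P`. -/
noncomputable def typeCode (P Pbar : PMF (X × Y₁ × Y₂)) {W₂ : ℕ} (w w' : Fin W₂) (t : ℝ)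
    (s : PMF X → Fin 2) (m₀ m₁ : Fin 2) (n : ℕ) [NeZero n] : Code X Y₁ Y₂ 2 W₂ n where
  φ₁ x := s (empPMF x)
  φ₂ _ y := if Near t (margY₁ P) (empPMF y) then w else w'
  ψ₁ m y := if m = m₁ ∧ Near t (margY₁ Pbar) (empPMF y) then 1 else 0
  ψ₂ m m₂ y := if m = m₀ ∧ m₂ = w ∧ Near t (margY₂ P) (empPMF y) then 0 else 1

lemma tendsto_ofReal_div_nat (C : ℝ) :
    Tendsto (fun n : ℕ => ENNReal.ofReal (C / n)) atTop (nhds 0) := by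
  have h : Tendsto (fun n : ℕ => C / n) atTop (nhds 0) := tendsto_const_div_atTop_nhds_zero_nat C
  simpa using ENNReal.tendsto_ofReal h

/-- A polynomial prefactor does not affect the exponent. -/
lemma eventually_pow_mul_exp_le (k : ℕ) {d ε : ℝ} (hε : 0 < ε) :
    ∀ᶠ n : ℕ in atTop,
      ((n : ℝ) + 1) ^ k * Real.exp (-(n * d)) ≤ Real.exp (-(n * (d - ε))) := by
  have h1 : Tendsto (fun x : ℝ => x ^ k * Real.exp (-ε * x)) atTop (nhds 0) := by
    simpa using tendsto_rpow_mul_exp_neg_mul_atTop_nhds_zero (k : ℝ) ε hε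
  have h2 : Tendsto (fun n : ℕ => (n : ℝ) + 1) atTop atTop :=
    tendsto_atTop_add_const_right _ _ tendsto_natCast_atTop_atTop
  filter_upwards [(h1.comp h2).eventually (gt_mem_nhds (Real.exp_pos (-ε)))] with n hn
  simp only [Function.comp_apply] at hn
  have e1 : Real.exp (-(n * d)) = Real.exp (-ε * (n + 1)) * Real.exp (ε + n * (ε - d)) := by
    rw [← Real.exp_add]; congr 1; ring
  have e2 : Real.exp (-(n * (d - ε))) = Real.exp (-ε) * Real.exp (ε + n * (ε - d)) := by
    rw [← Real.exp_add]; congr 1; ring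
  rw [e1, e2, ← mul_assoc]
  exact mul_le_mul_of_nonneg_right hn.le (Real.exp_pos _).le

lemma iidReal_le_one {α : Type*} [Fintype α] (p : PMF α) (n : ℕ) (E : Set (Fin n → α)) :
    iidReal p n E ≤ 1 := by
  have h := iidReal_compl p n E
  linarith [iidReal_nonneg p n Eᶜ]

lemma iidReal_union_le {α : Type*} [Fintype α] (p : PMF α) (n : ℕ) (E F : Set (Fin n → α)) :
    iidReal p n (E ∪ F) ≤ iidReal p n E + iidReal p n F := by
  rw [Set.union_eq_iUnion]
  refine (iidReal_iUnion_le p n _).trans ?_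
  simp

section Exponents

variable {W₂ : ℕ} {w w' : Fin W₂} {t : ℝ} {s : PMF X → Fin 2} {m₀ m₁ : Fin 2}

/-- Error probability of Detector 1 under `P`. The error event is an event of the pair of blocks of
the sensor and Detector 1, and the types in it satisfy the constraint up to a correction of their
marginals. -/
lemma typeCode_beta₁_le (hP : ∀ a, 0 < margXY₁ P a) {m : ℝ} (hm : 0 < m)
    (hPm : ∀ a, m ≤ (margXY₁ P a).toReal) (ht0 : 0 < t) (ht1 : t ≤ 1) {θ : ℝ}
    (hs : ∀ π, s π = m₁ → ∃ ν, Near t ν π ∧ ENNReal.ofReal θ ≤ minDiv₁ P Pbar {ν})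
    (n : ℕ) [NeZero n] :
    iidReal P n {z | (typeCode P Pbar w w' t s m₀ m₁ n).decision₁ z = 1} ≤
      ((n : ℝ) + 1) ^ Fintype.card (X × Y₁) * Real.exp (-(n * (θ - t * -Real.log m))) := by
  have hset : iidReal P n {z | (typeCode P Pbar w w' t s m₀ m₁ n).decision₁ z = 1} =
      iidReal (margXY₁ P) n {u : Fin n → X × Y₁ | s (empPMF fun i => (u i).1) = m₁ ∧
          Near t (margY₁ Pbar) (empPMF fun i => (u i).2)} := by
    rw [margXY₁, iidReal_map]
    congr 1
    ext z
    simp [Code.decision₁, typeCode]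
  rw [hset]
  refine iidReal_le_of_le_klSum _ hP _ ?_
  rintro u ⟨h1, h2⟩
  obtain ⟨ν, hν, hθ⟩ := hs _ h1
  rw [ofReal_le_minDiv₁_singleton_iff hP] at hθ
  rw [← map_empPMF u] at hν h2
  obtain ⟨p', hp1, hp2, hle⟩ := exists_marginals_eq hP hm hPm ht0 ht1 hν h2
  linarith [hθ p' hp1 hp2]

/-- Error probability of Detector 2 under `Pbar`. -/
lemma typeCode_beta₂_le (hPbar : ∀ a, 0 < Pbar a) {m : ℝ} (hm : 0 < m)
    (hPm : ∀ a, m ≤ (Pbar a).toReal) (ht0 : 0 < t) (ht1 : t ≤ 1) {θ : ℝ} (hw : w' ≠ w)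
    (hs : ∀ π, s π = m₀ → ∃ ν, Near t ν π ∧ ENNReal.ofReal θ ≤ minDiv₂ P Pbar {ν})
    (n : ℕ) [NeZero n] :
    iidReal Pbar n {z | (typeCode P Pbar w w' t s m₀ m₁ n).decision₂ z = 0} ≤
      ((n : ℝ) + 1) ^ Fintype.card (X × Y₁ × Y₂) *
        Real.exp (-(n * (θ - t * -Real.log m))) := by
  refine iidReal_le_of_le_klSum _ hPbar _ ?_
  intro z hz
  have hz' : s (empPMF fun i => (z i).1) = m₀ ∧ Near t (margY₁ P) (empPMF fun i => (z i).2.1) ∧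
      Near t (margY₂ P) (empPMF fun i => (z i).2.2) := by
    simpa [Code.decision₂, typeCode, hw] using hz
  obtain ⟨h1, h2, h3⟩ := hz'
  obtain ⟨ν, hν, hθ⟩ := hs _ h1
  rw [ofReal_le_minDiv₂_singleton_iff hPbar] at hθ
  rw [← map_empPMF z (fun u => u.1)] at hν
  rw [← map_empPMF z (fun u => u.2.1)] at h2
  rw [← map_empPMF z (fun u => u.2.2)] at h3
  obtain ⟨p', hp, hp1, hp2, hle⟩ := exists_marginals_eq₃ hPbar hm hPm ht0 ht1 hν h2 h3
  linarith [hθ p' hp hp1 hp2]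

lemma exists_typeCode_alpha₁_le (ht0 : 0 < t) (hs : ∀ π, Near t (margX Pbar) π → s π = m₁) :
    ∃ C : ℝ, ∀ (n : ℕ) [NeZero n],
      iidReal Pbar n {z | (typeCode P Pbar w w' t s m₀ m₁ n).decision₁ z = 0} ≤ C / n := by
  obtain ⟨C, hC⟩ := exists_iidReal_not_near_le (margX Pbar) ht0
  obtain ⟨C₁, hC₁⟩ := exists_iidReal_not_near_le (margY₁ Pbar) ht0
  refine ⟨C + C₁, fun n _ => ?_⟩
  have h := hC n
  have h₁ := hC₁ n
  rw [margX, iidReal_map] at h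
  rw [margY₁, iidReal_map] at h₁
  rw [add_div]
  refine (iidReal_mono _ _ ?_).trans ((iidReal_union_le _ _ _ _).trans (add_le_add h h₁))
  intro z hz
  by_contra hcon
  have hcon' : Near t (margX Pbar) (empPMF fun i => (z i).1) ∧
      Near t (margY₁ Pbar) (empPMF fun i => (z i).2.1) := by
    simpa [not_or, margX, margY₁] using hcon
  have : (typeCode P Pbar w w' t s m₀ m₁ n).decision₁ z = 1 := by
    simp [Code.decision₁, typeCode, hs _ hcon'.1, hcon'.2]
  exact absurd (hz.symm.trans this) (by decide)

lemma exists_typeCode_alpha₂_le (ht0 : 0 < t) (hs : ∀ π, Near t (margX P) π → s π = m₀) :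
    ∃ C : ℝ, ∀ (n : ℕ) [NeZero n],
      iidReal P n {z | (typeCode P Pbar w w' t s m₀ m₁ n).decision₂ z = 1} ≤ C / n := by
  obtain ⟨C, hC⟩ := exists_iidReal_not_near_le (margX P) ht0
  obtain ⟨C₁, hC₁⟩ := exists_iidReal_not_near_le (margY₁ P) ht0
  obtain ⟨C₂, hC₂⟩ := exists_iidReal_not_near_le (margY₂ P) ht0
  refine ⟨C + C₁ + C₂, fun n _ => ?_⟩
  have h := hC n
  have h₁ := hC₁ n
  have h₂ := hC₂ n
  rw [margX, iidReal_map] at h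
  rw [margY₁, iidReal_map] at h₁
  rw [margY₂, iidReal_map] at h₂
  rw [add_div, add_div]
  refine (iidReal_mono _ _ ?_).trans ((iidReal_union_le _ _ _ _).trans
    (add_le_add ((iidReal_union_le _ _ _ _).trans (add_le_add h h₁)) h₂))
  intro z hz
  by_contra hcon
  have hcon' : (Near t (margX P) (empPMF fun i => (z i).1) ∧
      Near t (margY₁ P) (empPMF fun i => (z i).2.1)) ∧
      Near t (margY₂ P) (empPMF fun i => (z i).2.2) := by
    simpa [not_or, margX, margY₁, margY₂] using hcon
  have : (typeCode P Pbar w w' t s m₀ m₁ n).decision₂ z = 0 := by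
    simp [Code.decision₂, typeCode, hs _ hcon'.1.1, hcon'.1.2, hcon'.2]
  exact absurd (hz.symm.trans this) (by decide)

end Exponents

lemma limsup_ofReal_le_zero {r : ℕ → ℝ} {C : ℝ} (h : ∀ n ≠ 0, r n ≤ C / n) :
    limsup (fun n => ENNReal.ofReal (r n)) atTop ≤ 0 := by
  rw [← (tendsto_ofReal_div_nat C).limsup_eq]
  refine limsup_le_limsup ?_
  filter_upwards [eventually_ne_atTop 0] with n hn
  exact ENNReal.ofReal_le_ofReal (h n hn)

lemma max_le_liminf_exponent {r : ℕ → ℝ} {k : ℕ} {d ε θ : ℝ} (hε : 0 < ε) (hθ : θ ≤ d - ε)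
    (h1 : ∀ n, r n ≤ 1)
    (h : ∀ n : ℕ, n ≠ 0 → r n ≤ ((n : ℝ) + 1) ^ k * Real.exp (-(n * d))) :
    ((max θ 0 : ℝ) : EReal) ≤ liminf (fun n : ℕ =>
      -(ENNReal.log (ENNReal.ofReal (r n))) / (n : EReal)) atTop := by
  refine le_liminf_of_le (by isBoundedDefault) ?_
  filter_upwards [eventually_pow_mul_exp_le k (d := d) hε, eventually_ne_atTop 0] with n hn hn0
  refine le_neg_log_div (Nat.pos_of_ne_zero hn0) ?_
  rcases le_total θ 0 with h0 | h0
  · rw [max_eq_right h0]; simpa using h1 n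
  · rw [max_eq_left h0]
    refine (h n hn0).trans (hn.trans (Real.exp_le_exp.2 ?_))
    have := mul_le_mul_of_nonneg_left hθ (Nat.cast_nonneg (α := ℝ) n)
    linarith

/-- A rule mapping types to bits yields the exponents for which each type, up to a small
perturbation, satisfies the constraint of the detector that its bit could mislead. -/
lemma achievable_of_rule (hP : ∀ a, 0 < margXY₁ P a) (hPbar : ∀ a, 0 < Pbar a) {W₂ : ℕ}
    (hW₂ : 2 ≤ W₂) {θ : ℝ × ℝ} {ε : ℝ} (hε : 0 < ε) {m₀ m₁ : Fin 2} {t₀ : ℝ} (ht₀ : 0 < t₀)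
    (hrule : ∀ t, 0 < t → t < t₀ → ∃ s : PMF X → Fin 2,
      (∀ π, Near t (margX P) π → s π = m₀) ∧ (∀ π, Near t (margX Pbar) π → s π = m₁) ∧
      (∀ π, s π = m₁ → ∃ ν, Near t ν π ∧ ENNReal.ofReal θ.1 ≤ minDiv₁ P Pbar {ν}) ∧
      (∀ π, s π = m₀ → ∃ ν, Near t ν π ∧ ENNReal.ofReal θ.2 ≤ minDiv₂ P Pbar {ν})) :
    Achievable P Pbar 0 2 W₂ (max (θ.1 - ε) 0, max (θ.2 - ε) 0) := by
  obtain ⟨a, ha, ha1, hPa⟩ := exists_pos_le_pmf _ hP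
  obtain ⟨b, hb, hb1, hPb⟩ := exists_pos_le_pmf _ hPbar
  have hla : 0 ≤ -Real.log a := neg_nonneg.2 (Real.log_nonpos ha.le ha1)
  have hlb : 0 ≤ -Real.log b := neg_nonneg.2 (Real.log_nonpos hb.le hb1)
  set M : ℝ := -Real.log a + -Real.log b + 1 with hM
  have hMpos : 0 < M := by linarith
  -- The parameter is so small that correcting the marginals costs at most `ε / 2`.
  set t : ℝ := min (t₀ / 2) (min 1 (ε / (2 * M))) with ht
  have ht0 : 0 < t := lt_min (by linarith) (lt_min one_pos (by positivity))
  have ht1 : t ≤ 1 := (min_le_right _ _).trans (min_le_left _ _)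
  have htt : t < t₀ := (min_le_left _ _).trans_lt (by linarith)
  have htM : t * M ≤ ε / 2 := by
    have : t ≤ ε / (2 * M) := (min_le_right _ _).trans (min_le_right _ _)
    rw [le_div_iff₀ (by positivity)] at this
    linarith
  have hta : t * -Real.log a ≤ ε / 2 :=
    (mul_le_mul_of_nonneg_left (by linarith) ht0.le).trans htM
  have htb : t * -Real.log b ≤ ε / 2 :=
    (mul_le_mul_of_nonneg_left (by linarith) ht0.le).trans htM
  obtain ⟨s, hs₀, hs₁, hd₁, hd₂⟩ := hrule t ht0 htt
  let w : Fin W₂ := ⟨0, by omega⟩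
  let w' : Fin W₂ := ⟨1, by omega⟩
  have hw : w' ≠ w := by simp [w, w']
  obtain ⟨C₁, hC₁⟩ := exists_typeCode_alpha₁_le (P := P) (w := w) (w' := w') (m₀ := m₀) ht0 hs₁
  obtain ⟨C₂, hC₂⟩ := exists_typeCode_alpha₂_le (Pbar := Pbar) (w := w) (w' := w') (m₁ := m₁)
    ht0 hs₀
  have hcode : ∀ n : ℕ, ∃ c : Code X Y₁ Y₂ 2 W₂ n, n ≠ 0 →
      iidReal Pbar n {z | c.decision₁ z = 0} ≤ C₁ / n ∧
      iidReal P n {z | c.decision₂ z = 1} ≤ C₂ / n ∧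
      iidReal P n {z | c.decision₁ z = 1} ≤ ((n : ℝ) + 1) ^ Fintype.card (X × Y₁) *
        Real.exp (-(n * (θ.1 - t * -Real.log a))) ∧
      iidReal Pbar n {z | c.decision₂ z = 0} ≤ ((n : ℝ) + 1) ^ Fintype.card (X × Y₁ × Y₂) *
        Real.exp (-(n * (θ.2 - t * -Real.log b))) := by
    intro n
    -- The empty block has no type, and any scheme will do for it.
    rcases eq_or_ne n 0 with h0 | h0
    · exact ⟨⟨fun _ => 0, fun _ _ => w, fun _ _ => 0, fun _ _ _ => 0⟩, fun h => absurd h0 h⟩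
    · have : NeZero n := ⟨h0⟩
      exact ⟨typeCode P Pbar w w' t s m₀ m₁ n, fun _ => ⟨hC₁ n, hC₂ n,
        typeCode_beta₁_le hP ha hPa ht0 ht1 hd₁ n,
        typeCode_beta₂_le hPbar hb hPb ht0 ht1 hw hd₂ n⟩⟩
  choose c hc using hcode
  refine ⟨le_max_right _ _, le_max_right _ _, c, ?_, ?_, ?_, ?_⟩
  · simp only [Code.prob₁, iidProb_eq_ofReal]
    exact limsup_ofReal_le_zero fun n hn => (hc n hn).1
  · simp only [Code.prob₂, iidProb_eq_ofReal]
    exact limsup_ofReal_le_zero fun n hn => (hc n hn).2.1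
  · simp only [Code.prob₁, iidProb_eq_ofReal]
    exact max_le_liminf_exponent (half_pos hε) (by linarith) (fun n => iidReal_le_one _ _ _)
      fun n hn => (hc n hn).2.2.1
  · simp only [Code.prob₂, iidProb_eq_ofReal]
    exact max_le_liminf_exponent (half_pos hε) (by linarith) (fun n => iidReal_le_one _ _ _)
      fun n hn => (hc n hn).2.2.2

lemma achievable_of_sameBit (hP : ∀ a, 0 < margXY₁ P a) (hPbar : ∀ a, 0 < Pbar a) {W₂ : ℕ}
    (hW₂ : 2 ≤ W₂) {θ : ℝ × ℝ} {ε : ℝ} (hε : 0 < ε) (h : SameBit P Pbar θ) :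
    Achievable P Pbar 0 2 W₂ (max (θ.1 - ε) 0, max (θ.2 - ε) 0) := by
  classical
  refine achievable_of_rule hP hPbar hW₂ hε (m₀ := 0) (m₁ := 0) one_pos fun t ht0 _ =>
    ⟨fun π => if Near t (margX P) π ∨ Near t (margX Pbar) π then 0 else 1,
      fun π hπ => if_pos (Or.inl hπ), fun π hπ => if_pos (Or.inr hπ), fun π hπ => ?_,
      fun π hπ => ?_⟩
  all_goals
    have hnear : Near t (margX P) π ∨ Near t (margX Pbar) π := by
      by_contra hcon
      simp [hcon] at hπ
  · rcases hnear with hn | hn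
    · exact ⟨_, hn, (h _ (Or.inl rfl)).1⟩
    · exact ⟨_, hn, (h _ (Or.inr rfl)).1⟩
  · rcases hnear with hn | hn
    · exact ⟨_, hn, (h _ (Or.inl rfl)).2⟩
    · exact ⟨_, hn, (h _ (Or.inr rfl)).2⟩

lemma achievable_of_diffBit (hP : ∀ a, 0 < margXY₁ P a) (hPbar : ∀ a, 0 < Pbar a)
    (hX : margX P ≠ margX Pbar) {W₂ : ℕ} (hW₂ : 2 ≤ W₂) {θ : ℝ × ℝ} {ε : ℝ} (hε : 0 < ε)
    (h : DiffBit P Pbar θ) :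
    Achievable P Pbar 0 2 W₂ (max (θ.1 - ε) 0, max (θ.2 - ε) 0) := by
  classical
  obtain ⟨ha, hb, hc⟩ := h
  obtain ⟨t₀, ht₀, hdisj⟩ := exists_not_near_of_ne hX
  refine achievable_of_rule hP hPbar hW₂ hε (m₀ := 0) (m₁ := 1) ht₀ fun t ht0 htt =>
    ⟨fun π => if Near t (margX Pbar) π then 1 else if Near t (margX P) π then 0 else
      if ENNReal.ofReal θ.1 ≤ minDiv₁ P Pbar {π} then 1 else 0,
      fun π hπ => ?_, fun π hπ => if_pos hπ, fun π hπ => ?_, fun π hπ => ?_⟩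
  · simp [hdisj t htt π hπ, hπ]
  · by_cases h1 : Near t (margX Pbar) π
    · exact ⟨_, h1, hb⟩
    by_cases h2 : Near t (margX P) π
    · simp [h1, h2] at hπ
    by_cases h3 : ENNReal.ofReal θ.1 ≤ minDiv₁ P Pbar {π}
    · exact ⟨_, near_self ht0.le π, h3⟩
    · simp [h1, h2, h3] at hπ
  · by_cases h1 : Near t (margX Pbar) π
    · simp [h1] at hπ
    by_cases h2 : Near t (margX P) π
    · exact ⟨_, h2, ha⟩
    by_cases h3 : ENNReal.ofReal θ.1 ≤ minDiv₁ P Pbar {π}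
    · simp [h1, h2, h3] at hπ
    · exact ⟨_, near_self ht0.le π, (hc π).resolve_left h3⟩

/-- The exponents are truncated at `0`, since achievable pairs are nonnegative. -/
lemma mem_closure_of_forall_achievable {W₂ : ℕ} {θ : ℝ × ℝ} (h1 : 0 ≤ θ.1) (h2 : 0 ≤ θ.2)
    (h : ∀ ε > 0, Achievable P Pbar 0 2 W₂ (max (θ.1 - ε) 0, max (θ.2 - ε) 0)) :
    θ ∈ exponentsRegion P Pbar 0 2 W₂ := by
  have htend : Tendsto (fun ε : ℝ => (max (θ.1 - ε) 0, max (θ.2 - ε) 0))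
      (nhdsWithin 0 (Set.Ioi 0)) (nhds θ) := by
    have hcont : Continuous fun ε : ℝ => (max (θ.1 - ε) 0, max (θ.2 - ε) 0) := by fun_prop
    have := hcont.tendsto 0
    simp only [sub_zero, max_eq_left h1, max_eq_left h2] at this
    exact this.mono_left nhdsWithin_le_nhds
  exact mem_closure_of_tendsto htend (eventually_mem_nhdsWithin.mono fun ε hε => h ε hε)

end Direct

end DistributedTesting

theorem mainTheorem1 {X Y₁ Y₂ : Type*} [Fintype X] [Fintype Y₁] [Fintype Y₂]
    (P Pbar : PMF (X × Y₁ × Y₂))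
    (hP : ∀ (x : X) (y₁ : Y₁), 0 < DistributedTesting.margXY₁ P (x, y₁))
    (hPbar : ∀ (x : X) (y₁ : Y₁) (y₂ : Y₂), 0 < Pbar (x, y₁, y₂))
    (hX : DistributedTesting.margX P ≠ DistributedTesting.margX Pbar)
    (W₂ : ℕ) (hW₂ : 2 ≤ W₂) :
    DistributedTesting.exponentsRegion P Pbar 0 2 W₂ =
      {θ : ℝ × ℝ | 0 ≤ θ.1 ∧ 0 ≤ θ.2 ∧
        ∃ (r : ℝ) (b : Fin 2 → Fin 2),
          (b = DistributedTesting.bSame ∨ b = DistributedTesting.bDiff) ∧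
          ENNReal.ofReal θ.1 ≤ DistributedTesting.minDiv₁ P Pbar
            (DistributedTesting.Gam P Pbar b r (b 1)) ∧
          ENNReal.ofReal θ.2 ≤ DistributedTesting.minDiv₂ P Pbar
            (DistributedTesting.Gam P Pbar b r (b 0))} := by
  have hP' : ∀ a, 0 < DistributedTesting.margXY₁ P a := fun a => hP a.1 a.2
  have hPbar' : ∀ a, 0 < Pbar a := fun a => hPbar a.1 a.2.1 a.2.2
  refine Set.Subset.antisymm ?_ ?_
  · have hclosed : IsClosed {θ : ℝ × ℝ | 0 ≤ θ.1 ∧ 0 ≤ θ.2 ∧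
        (DistributedTesting.SameBit P Pbar θ ∨ DistributedTesting.DiffBit P Pbar θ)} :=
      (isClosed_le continuous_const continuous_fst).inter
        ((isClosed_le continuous_const continuous_snd).inter
          DistributedTesting.isClosed_sameBit_or_diffBit)
    intro θ hθ
    have hsub : {θ | DistributedTesting.Achievable P Pbar 0 2 W₂ θ} ⊆ {θ : ℝ × ℝ | 0 ≤ θ.1 ∧
        0 ≤ θ.2 ∧
        (DistributedTesting.SameBit P Pbar θ ∨ DistributedTesting.DiffBit P Pbar θ)} :=
      fun θ' hθ' => ⟨hθ'.1, hθ'.2.1,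
        DistributedTesting.sameBit_or_diffBit_of_achievable hP' hPbar' (by omega) hθ'⟩
    have hmem := closure_minimal hsub hclosed hθ
    exact ⟨hmem.1, hmem.2.1,
      (DistributedTesting.exists_threshold_iff hX hmem.1 hmem.2.1).2 hmem.2.2⟩
  · rintro θ ⟨h1, h2, h⟩
    refine DistributedTesting.mem_closure_of_forall_achievable h1 h2 fun ε hε => ?_
    rcases (DistributedTesting.exists_threshold_iff hX h1 h2).1 h with hs | hd
    · exact DistributedTesting.achievable_of_sameBit hP' hPbar' hW₂ hε hs
    · exact DistributedTesting.achievable_of_diffBit hP' hPbar' hX hW₂ hε hd
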